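/- Let $X\subseteq\mathbb{R}^D$ be convex and let $\rho$ be a measurable probability density on $\mathbb{R}^D$ that vanishes outside $X$ and is comparable on $X$ to a strongly log-concave function: there are $0<c\le C$ and a function $V$, strongly convex on $X$, with $c\,e^{-V}\le\rho\le C\,e^{-V}$ on $X$. (For example: $X$ bounded and $\rho$ bounded above and away from $0$ on $X$; or $X=\mathbb{R}^D$ and $\rho$ a nondegenerate Gaussian density.) Then there is a constant $C_1=C_1(X,\rho)>0$ such that the following holds for all integers $1\le d<D$, $N\ge 1$, $s\ge 0$ and all data as described below. *Function and active subspace.* Let $f$ be a measurable real function, differentiable in the interior of $X$, with $f$ and $\nabla f$ in $L^2(\rho)$. Let $\Sigma_f=\int_X\nabla f(x)\,\nabla f(x)^\top\rho(x)\,dx=W\,\mathrm{diag}(\lambda_1,\dots,\lambda_D)\,W^\top$ with $W$ orthogonal and $\lambda_1\ge\dots\ge\lambda_D$. Let $\hat W$ be an orthogonal matrix (the computed one) with $\|W-\hat W\|_2\le\delta_1$, and write $\hat W=[\hat W_1,\hat W_2]$, where $\hat W_1$ consists of the first $d$ columns. *Monte Carlo.* Put $p_Y(y)=\int_{\mathbb{R}^{D-d}}\rho(\hat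 W_1y+\hat W_2z)\,dz$ and, when $p_Y(y)>0$, $p_{Z|Y}(z|y)=\rho(\hat W_1y+\hat W_2z)/p_Y(y)$. Let $z_1(y),\dots,z_N(y)$ be random points, jointly measurable in $y$ and the random outcome, which for each $y$ with $p_Y(y)>0$ are independent with density $p_{Z|Y}(\cdot|y)$. Put $f_{\mathrm{MC}}(y)=\frac1N\sum_{i=1}^N f(\hat W_1y+\hat W_2z_i(y))$ and, for a bias $\beta\ge 0$, $f^{(\beta)}_{\mathrm{MC}}=f_{\mathrm{MC}}+\beta$. *Gaussian process regression.* Let $k$ be a measurable (symmetric, positive semidefinite) covariance kernel on $\mathbb{R}^d$ and let $y_{\mathrm{tr}}=(y_1,\dots,y_s)$ be fixed training points in $\hat W_1^\top X$ for which the Gram matrix $k(y_{\mathrm{tr}},y_{\mathrm{tr}})$ is invertible. Let $$f^{(\beta)}_{\mathrm{GPR}}(y)=k(y,y_{\mathrm{tr}})\,k(y_{\mathrm{tr}},y_{\mathrm{tr}})^{-1}\big(f^{(\beta)}_{\mathrm{MC}}(y_j)\big)_{j=1}^s$$ be the mean of the noiseless Gaussian process regression trained on the biased data. For a random function $g$ on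 $X$ write $\|g\|_{2,\rho}=\big(\mathbb{E}\int_X g(x)^2\rho(x)\,dx\big)^{1/2}$, the expectation being over the Monte Carlo samples; functions of $y$ are evaluated at $y=\hat W_1^\top x$. If $C_2,\delta_2\ge 0$ satisfy $\|f^{(\beta)}_{\mathrm{MC}}-f^{(\beta)}_{\mathrm{GPR}}\|_{2,\rho}\le C_2\delta_2$, then $$\|f-f^{(\beta)}_{\mathrm{GPR}}\|_{2,\rho}\le C_1\Big(1+\frac1{\sqrt N}\Big)\Big(\delta_1\sqrt{\textstyle\sum_{i=1}^d\lambda_i}+\sqrt{\textstyle\sum_{i=d+1}^D\lambda_i}\Big)+C_2\delta_2+\beta .$$ -/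

import Mathlib

open MeasureTheory ProbabilityTheory

noncomputable section

namespace ActiveSubspace

/-- `ℝⁿ` with its Euclidean norm and Lebesgue measure. -/
abbrev E (n : ℕ) : Type := EuclideanSpace ℝ (Fin n)

/-- A probability density `ρ` on a convex domain `X ⊆ ℝᴰ`, extended by zero outside `X`, that is
comparable on `X`, up to multiplicative constants `0 < c ≤ C`, to a strongly log-concave function
`exp (-V)`. For bounded `X` this contains every density that is bounded above and away from zero
on `X` (take `V x = ‖x‖² / 2`); for `X = ℝᴰ` it contains the nondegenerate Gaussian densities. -/
structure IsAdmissibleDensity {D : ℕ} (X : Set (E D)) (ρ : E D → ℝ) : Prop where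
  convex : Convex ℝ X
  measurable : Measurable ρ
  eq_zero_of_notMem : ∀ x, x ∉ X → ρ x = 0
  integral_eq_one : ∫ x, ρ x = 1
  comparable : ∃ (V : E D → ℝ) (α c C : ℝ), 0 < α ∧ 0 < c ∧ StrongConvexOn X α V ∧
    ∀ x ∈ X, c * Real.exp (-V x) ≤ ρ x ∧ ρ x ≤ C * Real.exp (-V x)

/-- The measure `ρ(x) dx`. -/
def densityMeasure {D : ℕ} (ρ : E D → ℝ) : Measure (E D) :=
  volume.withDensity fun x => ENNReal.ofReal (ρ x)

/-- The matrix `Σ_f = ∫ ∇f(x) ⊗ ∇f(x) ρ(x) dx`. -/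
def gradientCovariance {D : ℕ} (ρ f : E D → ℝ) : Matrix (Fin D) (Fin D) ℝ :=
  Matrix.of fun i j => ∫ x, gradient f x i * gradient f x j ∂(densityMeasure ρ)

/-- `S = W Λ Wᵀ` with `W` orthogonal and `Λ = diag(lam)`, `lam` in decreasing order. -/
structure IsEigendecomposition {D : ℕ} (S W : Matrix (Fin D) (Fin D) ℝ) (lam : Fin D → ℝ) :
    Prop where
  orthogonal : W ∈ Matrix.orthogonalGroup (Fin D) ℝ
  antitone : Antitone lam
  eq_mul : S = W * Matrix.diagonal lam * W.transpose

/-- `W₁`: the first `d` columns of `W`. -/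
def activeBlock {D d : ℕ} (hd : d < D) (W : Matrix (Fin D) (Fin D) ℝ) :
    Matrix (Fin D) (Fin d) ℝ :=
  W.submatrix id (Fin.castLE hd.le)

/-- `W₂`: the last `D - d` columns of `W`. -/
def inactiveBlock {D d : ℕ} (_hd : d < D) (W : Matrix (Fin D) (Fin D) ℝ) :
    Matrix (Fin D) (Fin (D - d)) ℝ :=
  W.submatrix id fun j => ⟨d + j.val, by omega⟩

/-- The active variable `y = W₁ᵀ x`. -/
def activeVar {D d : ℕ} (hd : d < D) (W : Matrix (Fin D) (Fin D) ℝ) (x : E D) : E d :=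
  WithLp.toLp 2 ((activeBlock hd W).transpose.mulVec x.ofLp)

/-- The point `W₁ y + W₂ z`. -/
def recombine {D d : ℕ} (hd : d < D) (W : Matrix (Fin D) (Fin D) ℝ) (y : E d) (z : E (D - d)) :
    E D :=
  WithLp.toLp 2 ((activeBlock hd W).mulVec y.ofLp + (inactiveBlock hd W).mulVec z.ofLp)

/-- The marginal density `p_Y(y) = ∫ ρ(W₁ y + W₂ z) dz`. -/
def marginalDensity {D d : ℕ} (hd : d < D) (W : Matrix (Fin D) (Fin D) ℝ) (ρ : E D → ℝ)
    (y : E d) : ℝ :=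
  ∫ z : E (D - d), ρ (recombine hd W y z)

/-- The conditional density `p_{Z|Y}(z|y) = ρ(W₁ y + W₂ z) / p_Y(y)`. -/
def condDensity {D d : ℕ} (hd : d < D) (W : Matrix (Fin D) (Fin D) ℝ) (ρ : E D → ℝ)
    (y : E d) (z : E (D - d)) : ℝ :=
  ρ (recombine hd W y z) / marginalDensity hd W ρ y

/-- A Monte Carlo sampler: for every `y` with `p_Y(y) > 0`, the points `Z 1 · y, …, Z N · y` are
independent with density `p_{Z|Y}(·|y)`. Nothing is assumed on the dependence between different
values of `y` besides joint measurability. -/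
structure IsConditionalSampler {D d N : ℕ} (hd : d < D) (W : Matrix (Fin D) (Fin D) ℝ)
    (ρ : E D → ℝ) {Ω : Type*} [MeasurableSpace Ω] (P : Measure Ω)
    (Z : Fin N → Ω → E d → E (D - d)) : Prop where
  measurable : ∀ i, Measurable fun p : Ω × E d => Z i p.1 p.2
  law : ∀ i y, 0 < marginalDensity hd W ρ y →
    P.map (fun ω => Z i ω y) =
      volume.withDensity fun z => ENNReal.ofReal (condDensity hd W ρ y z)
  indep : ∀ y, 0 < marginalDensity hd W ρ y → iIndepFun (fun i ω => Z i ω y) P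

/-- The Monte Carlo estimator `f_MC(y) = N⁻¹ ∑ᵢ f(W₁ y + W₂ zᵢ)`. -/
def fMC {D d N : ℕ} (hd : d < D) (W : Matrix (Fin D) (Fin D) ℝ) (f : E D → ℝ) {Ω : Type*}
    (Z : Fin N → Ω → E d → E (D - d)) (ω : Ω) (y : E d) : ℝ :=
  (1 / (N : ℝ)) * ∑ i, f (recombine hd W y (Z i ω y))

/-- The biased Monte Carlo estimator `f_MC^{(β)} = f_MC + β`. -/
def fMCBiased {D d N : ℕ} (hd : d < D) (W : Matrix (Fin D) (Fin D) ℝ) (f : E D → ℝ) {Ω : Type*}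
    (Z : Fin N → Ω → E d → E (D - d)) (β : ℝ) (ω : Ω) (y : E d) : ℝ :=
  fMC hd W f Z ω y + β

/-- A (measurable) covariance kernel: symmetric and positive semidefinite. -/
structure IsCovarianceKernel {d : ℕ} (k : E d → E d → ℝ) : Prop where
  measurable : Measurable fun p : E d × E d => k p.1 p.2
  posSemidef : ∀ (n : ℕ) (p : Fin n → E d), (Matrix.of fun i j => k (p i) (p j)).PosSemidef

/-- The Gram matrix `k(y_tr, y_tr)`. -/
def gram {d s : ℕ} (k : E d → E d → ℝ) (ytr : Fin s → E d) : Matrix (Fin s) (Fin s) ℝ :=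
  Matrix.of fun i j => k (ytr i) (ytr j)

/-- The mean `k(y, y_tr) (k(y_tr, y_tr) + σ² I)⁻¹ f_tr` of Gaussian process regression with noise
variance `σ²`. -/
def gprMean {d s : ℕ} (k : E d → E d → ℝ) (noiseVar : ℝ) (ytr : Fin s → E d) (ftr : Fin s → ℝ)
    (y : E d) : ℝ :=
  dotProduct (fun i => k y (ytr i))
    ((gram k ytr + noiseVar • (1 : Matrix (Fin s) (Fin s) ℝ))⁻¹.mulVec ftr)

/-- The noiseless GPR surrogate `f_GPR^{(β)}` trained on the biased data
`f_MC^{(β)}(y_1), …, f_MC^{(β)}(y_s)`. -/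
def fGPRBiased {D d N s : ℕ} (hd : d < D) (W : Matrix (Fin D) (Fin D) ℝ) (f : E D → ℝ)
    {Ω : Type*} (Z : Fin N → Ω → E d → E (D - d)) (k : E d → E d → ℝ) (ytr : Fin s → E d)
    (β : ℝ) (ω : Ω) (y : E d) : ℝ :=
  gprMean k 0 ytr (fun i => fMCBiased hd W f Z β ω (ytr i)) y

/-- The norm `‖g‖_{2,ρ} = (𝔼 ∫ g(x)² ρ(x) dx)^{1/2}` of a random function `g` on `X`. -/
def rmsNorm {D : ℕ} (ρ : E D → ℝ) {Ω : Type*} [MeasurableSpace Ω] (P : Measure Ω)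
    (g : Ω → E D → ℝ) : ENNReal :=
  eLpNorm (fun p : E D × Ω => g p.2 p.1) 2 ((densityMeasure ρ).prod P)

end ActiveSubspace

end

/-!
The surrogate depends on `x` only through `y = Ŵ₁ᵀ x`, so the error is governed by the oscillation
of `f` on the fibers `z ↦ Ŵ₁ y + Ŵ₂ z`. Every conditional density is comparable to a strongly
log-concave one with the same constants as `ρ`, so all fibers satisfy a Poincaré inequality with one
constant, whatever their dimension and direction. It is obtained from the midpoint Prékopa–Leindler
inequality by Maurey's argument: linearizing an exponential moment bound gives the variance
bound for smooth functions; mollification and exhaustion carry it over to functions that are only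
differentiable inside the domain, and comparison of densities removes the log-concavity.

Integrated over `y`, the inequality bounds the mean square distance between `f` and its value at
one random point of the fiber by `∫ ‖Ŵ₂ᵀ ∇f‖² ρ`. Since `∫ (wᵢ ⋅ ∇f)² ρ = λᵢ`, this is at most
`(δ₁ √(λ₁ + ⋯ + λ_d) + √(λ_{d+1} + ⋯ + λ_D))²`. Minkowski's inequality carries this
bound over to the average of the `N` points.
-/

noncomputable section

namespace ActiveSubspace

open Set Filter Topology ENNReal
open scoped Convolution Pointwise

section PrekopaLeindler

/-! ### The midpoint Prékopa–Leindler inequality -/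

theorem volume_add_le_of_isCompact_of_midpoint_mem {A B C : Set ℝ} (hA : IsCompact A)
    (hB : IsCompact B) (hA₀ : A.Nonempty) (hB₀ : B.Nonempty)
    (h : ∀ a ∈ A, ∀ b ∈ B, midpoint ℝ a b ∈ C) :
    volume A + volume B ≤ 2 * volume C := by
  obtain ⟨a, ha, hAa⟩ := hA.exists_isGreatest hA₀
  obtain ⟨b, hb, hbB⟩ := hB.exists_isLeast hB₀
  have translates_subset : (· + b) '' A ∪ (a + ·) '' B ⊆ (2 : ℝ) • C := by
    rintro _ (⟨x, hx, rfl⟩ | ⟨x, hx, rfl⟩)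
    · exact ⟨midpoint ℝ x b, h x hx b hb, by simp [midpoint_eq_smul_add]⟩
    · exact ⟨midpoint ℝ a x, h a ha x hx, by simp [midpoint_eq_smul_add]⟩
  have translates_disjoint : AEDisjoint volume ((· + b) '' A) ((a + ·) '' B) := by
    refine measure_mono_null (t := {a + b}) ?_ (measure_singleton _)
    rintro _ ⟨⟨x, hx, rfl⟩, y, hy, hxy⟩
    have := hAa hx
    have := hbB hy
    simp only [mem_singleton_iff] at hxy ⊢
    linarith
  calc volume A + volume B
      = volume ((· + b) '' A) + volume ((a + ·) '' B) := by simp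
    _ = volume ((· + b) '' A ∪ (a + ·) '' B) :=
        (measure_union₀ (hB.image (by fun_prop)).measurableSet.nullMeasurableSet
          translates_disjoint).symm
    _ ≤ volume ((2 : ℝ) • C) := measure_mono translates_subset
    _ = 2 * volume C := by simp [Measure.addHaar_smul]

theorem volume_add_le_of_midpoint_mem {A B C : Set ℝ} (hA : MeasurableSet A)
    (hB : MeasurableSet B) (hA₀ : A.Nonempty) (hB₀ : B.Nonempty)
    (h : ∀ a ∈ A, ∀ b ∈ B, midpoint ℝ a b ∈ C) :
    volume A + volume B ≤ 2 * volume C := by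
  obtain ⟨a, ha⟩ := hA₀
  obtain ⟨b, hb⟩ := hB₀
  rw [hA.measure_eq_iSup_isCompact, hB.measure_eq_iSup_isCompact]
  simp only [iSup_and']
  refine ENNReal.biSup_add_biSup_le' (p := fun K => K ⊆ A ∧ IsCompact K)
    (q := fun K => K ⊆ B ∧ IsCompact K) ⟨∅, by simp⟩ ⟨∅, by simp⟩ ?_
  rintro K ⟨hKA, hK⟩ L ⟨hLB, hL⟩
  calc volume K + volume L ≤ volume (insert a K) + volume (insert b L) := by
        gcongr <;> exact subset_insert _ _
    _ ≤ 2 * volume C :=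
        volume_add_le_of_isCompact_of_midpoint_mem (hK.insert a) (hL.insert b)
          (insert_nonempty _ _) (insert_nonempty _ _) fun x hx y hy =>
            h x (insert_subset ha hKA hx) y (insert_subset hb hLB hy)

theorem lintegral_eq_lintegral_meas_ofReal_lt {α : Type*} [MeasurableSpace α] (μ : Measure α)
    {u : α → ℝ≥0∞} (hu : Measurable u) (hu_top : ∀ x, u x ≠ ∞) :
    ∫⁻ x, u x ∂μ = ∫⁻ t in Ioi (0 : ℝ), μ {x | ENNReal.ofReal t < u x} := by
  calc ∫⁻ x, u x ∂μ = ∫⁻ x, ENNReal.ofReal (u x).toReal ∂μ := by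
        simp only [ofReal_toReal (hu_top _)]
    _ = ∫⁻ t in Ioi (0 : ℝ), μ {x | t < (u x).toReal} :=
        lintegral_eq_lintegral_meas_lt μ (.of_forall fun _ => toReal_nonneg)
          hu.ennreal_toReal.aemeasurable
    _ = ∫⁻ t in Ioi (0 : ℝ), μ {x | ENNReal.ofReal t < u x} :=
        setLIntegral_congr_fun measurableSet_Ioi fun t ht => by
          simp only [ofReal_lt_iff_lt_toReal (mem_Ioi.1 ht).le (hu_top _)]

theorem measurable_meas_ofReal_lt {α : Type*} [MeasurableSpace α] (μ : Measure α)
    (u : α → ℝ≥0∞) : Measurable fun t : ℝ => μ {x | ENNReal.ofReal t < u x} :=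
  Antitone.measurable fun _ _ hst =>
    measure_mono fun _ hx => (ENNReal.ofReal_le_ofReal hst).trans_lt hx

/-- Every superlevel set of `H` contains the midpoints of the superlevel sets of `F` and `G`, which
are nonempty at the same levels, so the one-dimensional Brunn–Minkowski inequality applies level by
level. -/
theorem lintegral_add_le_of_iSup_eq_one {F G H : ℝ → ℝ≥0∞} (hF : Measurable F)
    (hG : Measurable G) (hH : Measurable H) (hF₁ : ⨆ x, F x = 1) (hG₁ : ⨆ x, G x = 1)
    (h : ∀ x y, F x * G y ≤ H (midpoint ℝ x y) ^ 2) :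
    (∫⁻ x, F x) + ∫⁻ x, G x ≤ 2 * ∫⁻ x, H x := by
  have F_le (x : ℝ) : F x ≤ 1 := hF₁ ▸ le_iSup F x
  have G_le (x : ℝ) : G x ≤ 1 := hG₁ ▸ le_iSup G x
  have lt_H {t x y : ℝ} (hx : ENNReal.ofReal t < F x) (hy : ENNReal.ofReal t < G y) :
      ENNReal.ofReal t < min (H (midpoint ℝ x y)) 1 := by
    refine lt_min (lt_of_not_ge fun hle => ?_) (hx.trans_le (F_le x))
    exact ((ENNReal.mul_lt_mul hx hy).trans_le (h x y)).not_ge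
      (sq (ENNReal.ofReal t) ▸ pow_le_pow_left' hle 2)
  suffices (∫⁻ x, F x) + ∫⁻ x, G x ≤ 2 * ∫⁻ x, min (H x) 1 from
    this.trans (by gcongr; exact min_le_left _ _)
  rw [lintegral_eq_lintegral_meas_ofReal_lt _ hF fun x => ne_top_of_le_ne_top one_ne_top (F_le x),
    lintegral_eq_lintegral_meas_ofReal_lt _ hG fun x => ne_top_of_le_ne_top one_ne_top (G_le x),
    lintegral_eq_lintegral_meas_ofReal_lt _ (hH.min measurable_const)
      fun x => ne_top_of_le_ne_top one_ne_top (min_le_right _ _),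
    ← lintegral_add_left (measurable_meas_ofReal_lt _ F),
    ← lintegral_const_mul _ (measurable_meas_ofReal_lt _ _)]
  refine lintegral_mono fun t => ?_
  rcases lt_or_ge (ENNReal.ofReal t) 1 with ht | ht
  · exact volume_add_le_of_midpoint_mem (measurableSet_lt measurable_const hF)
      (measurableSet_lt measurable_const hG) (lt_iSup_iff.1 (ht.trans_eq hF₁.symm))
      (lt_iSup_iff.1 (ht.trans_eq hG₁.symm)) fun x hx y hy => lt_H hx hy
  · simp [((F_le _).trans ht).not_gt, ((G_le _).trans ht).not_gt]

theorem ennreal_four_mul_le_sq_add (x y : ℝ≥0∞) : 4 * (x * y) ≤ (x + y) ^ 2 := by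
  rcases eq_or_ne x ∞ with rfl | hx
  · simp
  rcases eq_or_ne y ∞ with rfl | hy
  · simp
  lift x to NNReal using hx
  lift y to NNReal using hy
  exact_mod_cast (mul_assoc 4 x y).symm.trans_le (_root_.four_mul_le_sq_add x y)

/-- The Prékopa–Leindler inequality at midpoints, as a property of a measure on a real vector
space. It is stated with squares in place of geometric means, so that no roots occur. -/
def MidpointPrekopaLeindler {α : Type*} [AddCommGroup α] [Module ℝ α] [MeasurableSpace α]
    (μ : Measure α) : Prop :=
  ∀ F G H : α → ℝ≥0∞, Measurable F → Measurable G → Measurable H →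
    (∀ x y, F x * G y ≤ H (midpoint ℝ x y) ^ 2) →
    (∫⁻ x, F x ∂μ) * (∫⁻ x, G x ∂μ) ≤ (∫⁻ x, H x ∂μ) ^ 2

theorem lintegral_mul_le_sq_of_iSup_ne_top {F G H : ℝ → ℝ≥0∞} (hF : Measurable F)
    (hG : Measurable G) (hH : Measurable H) (hF_top : ⨆ x, F x ≠ ∞) (hG_top : ⨆ x, G x ≠ ∞)
    (h : ∀ x y, F x * G y ≤ H (midpoint ℝ x y) ^ 2) :
    (∫⁻ x, F x) * (∫⁻ x, G x) ≤ (∫⁻ x, H x) ^ 2 := by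
  set a := ⨆ x, F x with ha
  set b := ⨆ x, G x with hb
  rcases eq_or_ne a 0 with ha₀ | ha₀
  · simp [iSup_eq_zero.1 (ha.symm.trans ha₀)]
  rcases eq_or_ne b 0 with hb₀ | hb₀
  · simp [iSup_eq_zero.1 (hb.symm.trans hb₀)]
  obtain ⟨c, hc⟩ : ∃ c, c ^ 2 = a * b :=
    ⟨(a * b) ^ (2⁻¹ : ℝ), by rw [← ENNReal.rpow_natCast, ← ENNReal.rpow_mul]; simp⟩
  have hab : a⁻¹ * b⁻¹ = (c⁻¹) ^ 2 := by
    rw [← ENNReal.mul_inv (.inl ha₀) (.inl hF_top), ← hc, ENNReal.inv_pow]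
  have hc₀ : (c⁻¹) ^ 2 ≠ 0 := by simp [← hab, hF_top, hG_top]
  have hc_top : (c⁻¹) ^ 2 ≠ ∞ := hab ▸ ENNReal.mul_ne_top (by simpa) (by simpa)
  have normalized : (∫⁻ x, F x) * a⁻¹ + (∫⁻ x, G x) * b⁻¹ ≤ 2 * ((∫⁻ x, H x) * c⁻¹) := by
    simp only [← lintegral_mul_const _ hF, ← lintegral_mul_const _ hG, ← lintegral_mul_const _ hH]
    refine lintegral_add_le_of_iSup_eq_one (hF.mul_const _) (hG.mul_const _) (hH.mul_const _)
      ?_ ?_ fun x y => ?_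
    · rw [← ENNReal.iSup_mul, ← ha, ENNReal.mul_inv_cancel ha₀ hF_top]
    · rw [← ENNReal.iSup_mul, ← hb, ENNReal.mul_inv_cancel hb₀ hG_top]
    · rw [mul_mul_mul_comm, hab, mul_pow]
      gcongr
      exact h x y
  have squared := (ennreal_four_mul_le_sq_add _ _).trans (pow_le_pow_left₀ zero_le normalized 2)
  rw [mul_mul_mul_comm, hab, mul_pow, mul_pow, show (2 : ℝ≥0∞) ^ 2 = 4 by norm_num,
    ENNReal.mul_le_mul_iff_right (by simp) (by simp),
    ENNReal.mul_le_mul_iff_left hc₀ hc_top] at squared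
  exact squared

theorem midpointPrekopaLeindler_real : MidpointPrekopaLeindler (volume : Measure ℝ) := by
  intro F G H hF hG hH h
  have truncated (m : ℕ) : (∫⁻ x, min (F x) m) * (∫⁻ x, min (G x) m) ≤ (∫⁻ x, H x) ^ 2 :=
    lintegral_mul_le_sq_of_iSup_ne_top (hF.min measurable_const) (hG.min measurable_const) hH
      (ne_top_of_le_ne_top (natCast_ne_top m) (iSup_le fun _ => min_le_right _ _))
      (ne_top_of_le_ne_top (natCast_ne_top m) (iSup_le fun _ => min_le_right _ _))
      fun x y => (mul_le_mul' (min_le_left _ _) (min_le_left _ _)).trans (h x y)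
  have mono (u : ℝ → ℝ≥0∞) : Monotone fun (m : ℕ) x => min (u x) m := fun m n hmn x =>
    min_le_min le_rfl (by exact_mod_cast hmn)
  have lintegral_eq (u : ℝ → ℝ≥0∞) (hu : Measurable u) :
      ∫⁻ x, u x = ⨆ m : ℕ, ∫⁻ x, min (u x) m := by
    rw [← lintegral_iSup (fun m => hu.min measurable_const) (mono u)]
    simp only [← inf_iSup_eq, ENNReal.iSup_natCast, inf_top_eq]
  simp only [lintegral_eq F hF, lintegral_eq G hG, ENNReal.iSup_mul, ENNReal.mul_iSup]
  exact iSup₂_le fun m n => (mul_le_mul' (lintegral_mono (mono F (le_max_right m n)))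
    (lintegral_mono (mono G (le_max_left m n)))).trans (truncated _)

variable {α β : Type*} [AddCommGroup α] [Module ℝ α] [MeasurableSpace α] [AddCommGroup β]
  [Module ℝ β] [MeasurableSpace β] {μ : Measure α} {ν : Measure β}

theorem MidpointPrekopaLeindler.prod [SFinite ν] (hμ : MidpointPrekopaLeindler μ)
    (hν : MidpointPrekopaLeindler ν) : MidpointPrekopaLeindler (μ.prod ν) := by
  intro F G H hF hG hH h
  rw [lintegral_prod _ hF.aemeasurable, lintegral_prod _ hG.aemeasurable,
    lintegral_prod _ hH.aemeasurable]
  refine hμ _ _ _ hF.lintegral_prod_right' hG.lintegral_prod_right' hH.lintegral_prod_right'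
    fun x y => hν _ _ _ (by fun_prop) (by fun_prop) (by fun_prop) fun s t => ?_
  simpa only [midpoint_eq_smul_add, Prod.mk_add_mk, Prod.smul_mk] using h (x, s) (y, t)

theorem MidpointPrekopaLeindler.of_measurePreserving (e : α →ₗ[ℝ] β)
    (he : MeasurePreserving e μ ν) (hμ : MidpointPrekopaLeindler μ) :
    MidpointPrekopaLeindler ν := by
  intro F G H hF hG hH h
  rw [← he.lintegral_comp hF, ← he.lintegral_comp hG, ← he.lintegral_comp hH]
  refine hμ _ _ _ (hF.comp he.measurable) (hG.comp he.measurable) (hH.comp he.measurable)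
    fun x y => ?_
  simpa only [midpoint_eq_smul_add, map_smul, map_add] using h (e x) (e y)

theorem MidpointPrekopaLeindler.smul (hμ : MidpointPrekopaLeindler μ) (c : ℝ≥0∞) :
    MidpointPrekopaLeindler (c • μ) := by
  intro F G H hF hG hH h
  simp only [lintegral_smul_measure, smul_eq_mul, mul_pow, sq c, mul_mul_mul_comm c]
  gcongr
  exact hμ F G H hF hG hH h

theorem midpointPrekopaLeindler_pi (n : ℕ) :
    MidpointPrekopaLeindler (volume : Measure (Fin n → ℝ)) := by
  induction n with
  | zero =>
    intro F G H _ _ _ h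
    simpa [volume_pi, Measure.pi_of_empty _ 0] using h 0 0
  | succ n ih =>
    refine .of_measurePreserving (Fin.consLinearEquiv ℝ fun _ => ℝ).toLinearMap ?_
      (midpointPrekopaLeindler_real.prod ih)
    convert! (volume_preserving_piFinSuccAbove (fun _ : Fin (n + 1) => ℝ) 0).symm using 1
    ext p i
    simp [MeasurableEquiv.piFinSuccAbove, Fin.insertNthEquiv]

theorem midpointPrekopaLeindler_of_isAddHaarMeasure {F : Type*} [NormedAddCommGroup F]
    [NormedSpace ℝ F] [FiniteDimensional ℝ F] [MeasurableSpace F] [BorelSpace F] (μ : Measure F)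
    [μ.IsAddHaarMeasure] : MidpointPrekopaLeindler μ := by
  let e : (Fin (Module.finrank ℝ F) → ℝ) ≃L[ℝ] F := ContinuousLinearEquiv.ofFinrankEq (by simp)
  have : (Measure.map e volume).IsAddHaarMeasure := e.isAddHaarMeasure_map volume
  rw [Measure.isAddLeftInvariant_eq_smul μ (Measure.map e volume)]
  exact (MidpointPrekopaLeindler.of_measurePreserving e.toLinearMap
    ⟨e.continuous.measurable, rfl⟩ (midpointPrekopaLeindler_pi _)).smul _

end PrekopaLeindler

section Linearization

/-! ### From exponential moment bounds to second moments -/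

theorem tendsto_exp_sub_one_sub_div_sq (a b : ℝ) :
    Tendsto (fun ε : ℝ => (Real.exp (ε * a - ε ^ 2 * b) - 1 - (ε * a - ε ^ 2 * b)) / ε ^ 2)
      (𝓝[>] 0) (𝓝 (a ^ 2 / 2)) := by
  set t : ℝ → ℝ := fun ε => ε * a - ε ^ 2 * b
  have factor (ε : ℝ) : t ε = ε * (a - ε * b) := by ring
  have lim_cofactor : Tendsto (fun ε : ℝ => a - ε * b) (𝓝[>] 0) (𝓝 a) :=
    tendsto_nhdsWithin_of_tendsto_nhds <|
      Continuous.tendsto' (by fun_prop) _ _ (by simp)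
  have t_small : Tendsto t (𝓝[>] 0) (𝓝 0) :=
    tendsto_nhdsWithin_of_tendsto_nhds <| Continuous.tendsto' (by fun_prop) _ _ (by simp [t])
  have t_isBigO : (fun ε => t ε ^ 2) =O[𝓝[>] 0] fun ε => ε ^ 2 := by
    refine Asymptotics.IsBigO.pow ?_ 2
    simpa only [← factor, mul_one] using
      (Asymptotics.isBigO_refl (fun ε : ℝ => ε) _).mul (lim_cofactor.isBigO_one ℝ)
  have taylor : Tendsto (fun ε => (Real.exp (t ε) - (1 + t ε + t ε ^ 2 / 2)) / ε ^ 2)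
      (𝓝[>] 0) (𝓝 0) := by
    simpa [Function.comp_def, Finset.sum_range_succ] using
      (((Real.exp_sub_sum_range_succ_isLittleO_pow 2).comp_tendsto t_small).trans_isBigO
        t_isBigO).tendsto_div_nhds_zero
  have := taylor.add ((lim_cofactor.pow 2).div_const 2)
  rw [zero_add] at this
  refine this.congr' ?_
  filter_upwards [self_mem_nhdsWithin] with ε hε
  have : ε ≠ 0 := (mem_Ioi.1 hε).ne'
  simp only [factor]
  field_simp
  ring

variable {α : Type*} [MeasurableSpace α] {π : Measure α} [IsFiniteMeasure π] {Δ q : α → ℝ}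

theorem integrable_exp_of_lintegral_le {u : α → ℝ} (hu : Measurable u)
    (h : ∫⁻ x, ENNReal.ofReal (Real.exp (u x)) ∂π ≤ π univ) :
    Integrable (fun x => Real.exp (u x)) π :=
  (lintegral_ofReal_ne_top_iff_integrable (by fun_prop)
    (.of_forall fun _ => (Real.exp_pos _).le)).1 (h.trans_lt (measure_lt_top _ _)).ne

theorem exp_remainder_nonneg (t ε : ℝ) : 0 ≤ (Real.exp t - 1 - t) / ε ^ 2 :=
  div_nonneg (by linarith [Real.add_one_le_exp t]) (sq_nonneg ε)

theorem lintegral_exp_remainder_le {ε : ℝ} (hε : 0 < ε) (hΔ : Measurable Δ) (hq : Measurable q)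
    (hΔ_int : Integrable Δ π) (hq_int : Integrable q π) (hΔ₀ : ∫ x, Δ x ∂π = 0)
    (h : ∫⁻ x, ENNReal.ofReal (Real.exp (ε * Δ x - ε ^ 2 * q x)) ∂π ≤ π univ) :
    ∫⁻ x, ENNReal.ofReal
        ((Real.exp (ε * Δ x - ε ^ 2 * q x) - 1 - (ε * Δ x - ε ^ 2 * q x)) / ε ^ 2) ∂π
      ≤ ENNReal.ofReal (∫ x, q x ∂π) := by
  have exp_int := integrable_exp_of_lintegral_le (by fun_prop) h
  have integral_exp_le : ∫ x, Real.exp (ε * Δ x - ε ^ 2 * q x) ∂π ≤ π.real univ := by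
    rw [integral_eq_lintegral_of_nonneg_ae (.of_forall fun _ => (Real.exp_pos _).le)
      exp_int.aestronglyMeasurable]
    exact ENNReal.toReal_mono (measure_ne_top _ _) h
  have exp_sub_one_int : Integrable (fun x => Real.exp (ε * Δ x - ε ^ 2 * q x) - 1) π :=
    exp_int.sub (integrable_const 1)
  have exponent_int : Integrable (fun x => ε * Δ x - ε ^ 2 * q x) π :=
    (hΔ_int.const_mul ε).sub (hq_int.const_mul (ε ^ 2))
  have remainder_int : Integrable (fun x =>
      (Real.exp (ε * Δ x - ε ^ 2 * q x) - 1 - (ε * Δ x - ε ^ 2 * q x)) / ε ^ 2) π :=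
    (exp_sub_one_int.sub exponent_int).div_const _
  rw [← ofReal_integral_eq_lintegral_ofReal remainder_int
    (.of_forall fun _ => exp_remainder_nonneg _ _)]
  refine ENNReal.ofReal_le_ofReal ?_
  rw [integral_div, integral_sub exp_sub_one_int exponent_int,
    integral_sub exp_int (integrable_const _),
    integral_sub (hΔ_int.const_mul ε) (hq_int.const_mul (ε ^ 2)), integral_const_mul,
    integral_const_mul, hΔ₀, integral_const, smul_eq_mul, mul_one, div_le_iff₀ (by positivity)]
  linarith

/-- The remainders `(exp t - 1 - t) / ε²` with `t = εΔ - ε²q` are nonnegative and converge to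
`Δ² / 2`, so Fatou's lemma applies. -/
theorem lintegral_sq_div_two_le_of_lintegral_exp_le (hΔ : Measurable Δ) (hq : Measurable q)
    (hΔ_int : Integrable Δ π) (hq_int : Integrable q π) (hΔ₀ : ∫ x, Δ x ∂π = 0)
    (h : ∀ᶠ ε in 𝓝[>] (0 : ℝ),
      ∫⁻ x, ENNReal.ofReal (Real.exp (ε * Δ x - ε ^ 2 * q x)) ∂π ≤ π univ) :
    ∫⁻ x, ENNReal.ofReal (Δ x ^ 2 / 2) ∂π ≤ ENNReal.ofReal (∫ x, q x ∂π) := by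
  set r : ℝ → α → ℝ≥0∞ := fun ε x => ENNReal.ofReal
    ((Real.exp (ε * Δ x - ε ^ 2 * q x) - 1 - (ε * Δ x - ε ^ 2 * q x)) / ε ^ 2)
  have r_le : ∀ᶠ ε in 𝓝[>] (0 : ℝ), ∫⁻ x, r ε x ∂π ≤ ENNReal.ofReal (∫ x, q x ∂π) := by
    filter_upwards [h, self_mem_nhdsWithin] with ε hexp hε
    exact lintegral_exp_remainder_le hε hΔ hq hΔ_int hq_int hΔ₀ hexp
  calc ∫⁻ x, ENNReal.ofReal (Δ x ^ 2 / 2) ∂π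
      = ∫⁻ x, liminf (fun ε => r ε x) (𝓝[>] 0) ∂π :=
        lintegral_congr fun x => (ENNReal.tendsto_ofReal
          (tendsto_exp_sub_one_sub_div_sq (Δ x) (q x))).liminf_eq.symm
    _ ≤ liminf (fun ε => ∫⁻ x, r ε x ∂π) (𝓝[>] 0) := lintegral_liminf_le fun ε => by fun_prop
    _ ≤ ENNReal.ofReal (∫ x, q x ∂π) :=
        (liminf_le_liminf r_le).trans_eq (liminf_const _)

end Linearization

section Energy

variable {α : Type*} [MeasurableSpace α]

/-- The integral of `|f x - f y|²` over independent `x` and `y`. For a finite measure it is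
`2 μ(univ)` times the integrated squared deviation of `f` from its mean; in this form the variance
side of a Poincaré inequality is monotone in the measure and involves no mean. -/
def pairEnergy (μ : Measure α) (f : α → ℝ) : ℝ≥0∞ :=
  ∫⁻ x, ∫⁻ y, ‖f x - f y‖ₑ ^ 2 ∂μ ∂μ

/-- The Dirichlet energy `∫ ‖∇f‖² dμ`, the gradient side of a Poincaré inequality. -/
def dirichletEnergy {F : Type*} [NormedAddCommGroup F] [NormedSpace ℝ F] [MeasurableSpace F]
    (μ : Measure F) (f : F → ℝ) : ℝ≥0∞ :=
  ∫⁻ x, ‖fderiv ℝ f x‖ₑ ^ 2 ∂μ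

theorem pairEnergy_eq_lintegral_prod {μ : Measure α} [SFinite μ] {f : α → ℝ} (hf : Measurable f) :
    pairEnergy μ f = ∫⁻ p, ‖f p.1 - f p.2‖ₑ ^ 2 ∂(μ.prod μ) :=
  (lintegral_prod (fun p : α × α => ‖f p.1 - f p.2‖ₑ ^ 2) (by fun_prop)).symm

theorem dirichletEnergy_eq_ofReal_integral {F : Type*} [NormedAddCommGroup F] [NormedSpace ℝ F]
    [MeasurableSpace F] {μ : Measure F} {f : F → ℝ} (hf : MemLp (fderiv ℝ f) 2 μ) :
    dirichletEnergy μ f = ENNReal.ofReal (∫ x, ‖fderiv ℝ f x‖ ^ 2 ∂μ) := by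
  rw [ofReal_integral_eq_lintegral_ofReal hf.norm.integrable_sq (.of_forall fun _ => sq_nonneg _)]
  simp only [dirichletEnergy, ENNReal.ofReal_pow (norm_nonneg _), ofReal_norm]

end Energy

section TestFunctions

/-! ### The Poincaré inequality for strongly log-concave measures: smooth functions -/

variable {F : Type*} [NormedAddCommGroup F] [NormedSpace ℝ F]

theorem two_mul_midpoint_le_of_strongConvexOn {K : Set F} {V : F → ℝ} {α : ℝ}
    (hV : StrongConvexOn K α V) {x y : F} (hx : x ∈ K) (hy : y ∈ K) :
    2 * V (midpoint ℝ x y) ≤ V x + V y - α / 4 * ‖x - y‖ ^ 2 := by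
  have := hV.2 hx hy (by simp : (0 : ℝ) ≤ ⅟2) (by simp : (0 : ℝ) ≤ ⅟2) (by norm_num)
  rw [← smul_add, ← midpoint_eq_smul_add] at this
  norm_num at this
  linarith

theorem sub_le_norm_fderiv_mul_add_sq {g : F → ℝ} (hg : Differentiable ℝ g) {L : NNReal}
    (hL : LipschitzWith L (fderiv ℝ g)) (x y : F) :
    g x - g y ≤ ‖fderiv ℝ g x‖ * ‖x - y‖ + L * ‖x - y‖ ^ 2 := by
  have fderiv_close : ∀ z ∈ segment ℝ y x, ‖fderiv ℝ g z - fderiv ℝ g x‖ ≤ L * ‖x - y‖ := by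
    intro z hz
    refine (hL.norm_sub_le z x).trans ?_
    gcongr
    rw [norm_sub_rev x y]
    exact norm_sub_le_of_mem_segment (segment_symm ℝ y x ▸ hz)
  have taylor : ‖g x - g y - fderiv ℝ g x (x - y)‖ ≤ L * ‖x - y‖ * ‖x - y‖ :=
    (convex_segment y x).norm_image_sub_le_of_norm_hasFDerivWithin_le'
      (fun z _ => (hg z).hasFDerivAt.hasFDerivWithinAt) fderiv_close
      (left_mem_segment ℝ y x) (right_mem_segment ℝ y x)
  have := (Real.le_norm_self _).trans taylor
  have := (Real.le_norm_self _).trans ((fderiv ℝ g x).le_opNorm (x - y))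
  linarith

/-- The two functions on the left form an admissible pair in Maurey's inequality
`lintegral_exp_mul_lintegral_exp_le`. -/
theorem perturbation_le_sq_norm_sub {g : F → ℝ} (hg : Differentiable ℝ g) {L : NNReal}
    (hL : LipschitzWith L (fderiv ℝ g)) {α ε : ℝ} (hα : 0 < α) (hε : 0 ≤ ε)
    (hεL : 8 * (ε * L) ≤ α) (x y : F) :
    ε * g x - ε ^ 2 * (2 / α * ‖fderiv ℝ g x‖ ^ 2) + -(ε * g y) ≤ α / 4 * ‖x - y‖ ^ 2 := by
  set r := ‖x - y‖
  set N := ‖fderiv ℝ g x‖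
  have first_order : ε * (g x - g y) ≤ ε * (N * r + L * r ^ 2) := by
    gcongr
    exact sub_le_norm_fderiv_mul_add_sq hg hL x y
  have young : ε * N * r ≤ ε ^ 2 * (2 / α * N ^ 2) + α / 8 * r ^ 2 := by
    have square_nonneg : 0 ≤ 2 / α * (ε * N - α / 4 * r) ^ 2 := by positivity
    have expand : 2 / α * (ε * N - α / 4 * r) ^ 2
        = ε ^ 2 * (2 / α * N ^ 2) - ε * N * r + α / 8 * r ^ 2 := by
      field_simp
      ring
    linarith
  have second_order : 8 * (ε * L) * r ^ 2 ≤ α * r ^ 2 := by gcongr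
  linarith

variable [MeasurableSpace F]

/-- The measure with density `exp (-V)` on `K` with respect to `μ`. The potential `V` is not
required to be meaningful outside `K`. -/
def gibbsMeasure (μ : Measure F) (K : Set F) (V : F → ℝ) : Measure F :=
  μ.withDensity (K.indicator fun x => ENNReal.ofReal (Real.exp (-V x)))

variable [FiniteDimensional ℝ F] [BorelSpace F] {μ : Measure F} [μ.IsAddHaarMeasure]
  {K : Set F} {V : F → ℝ} {α : ℝ}

/-- Maurey's property (τ). -/
theorem lintegral_exp_mul_lintegral_exp_le (hV : StrongConvexOn K α V)
    (hKV : Measurable (K.indicator fun x => ENNReal.ofReal (Real.exp (-V x)))) {u v : F → ℝ}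
    (hu : Measurable u) (hv : Measurable v) (huv : ∀ x y, u x + v y ≤ α / 4 * ‖x - y‖ ^ 2) :
    (∫⁻ x, ENNReal.ofReal (Real.exp (u x)) ∂(gibbsMeasure μ K V)) *
        (∫⁻ x, ENNReal.ofReal (Real.exp (v x)) ∂(gibbsMeasure μ K V))
      ≤ gibbsMeasure μ K V univ ^ 2 := by
  rw [gibbsMeasure, lintegral_withDensity_eq_lintegral_mul _ hKV (by fun_prop),
    lintegral_withDensity_eq_lintegral_mul _ hKV (by fun_prop),
    withDensity_apply _ MeasurableSet.univ, setLIntegral_univ]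
  refine midpointPrekopaLeindler_of_isAddHaarMeasure μ _ _ _ (hKV.mul (by fun_prop))
    (hKV.mul (by fun_prop)) hKV fun x y => ?_
  by_cases hx : x ∈ K
  swap
  · simp [hx]
  by_cases hy : y ∈ K
  swap
  · simp [hy]
  simp only [Pi.mul_apply, indicator_of_mem hx, indicator_of_mem hy,
    indicator_of_mem (hV.1.midpoint_mem hx hy)]
  rw [← ENNReal.ofReal_pow (Real.exp_pos _).le, ← ENNReal.ofReal_mul (Real.exp_pos _).le,
    ← ENNReal.ofReal_mul (Real.exp_pos _).le, ← ENNReal.ofReal_mul (by positivity),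
    ← Real.exp_add, ← Real.exp_add, ← Real.exp_add, ← Real.exp_nat_mul]
  refine ENNReal.ofReal_le_ofReal (Real.exp_le_exp.2 ?_)
  have := two_mul_midpoint_le_of_strongConvexOn hV hx hy
  have := huv x y
  push_cast
  linarith

theorem pairEnergy_le_of_lipschitzWith_fderiv (hα : 0 < α) (hV : StrongConvexOn K α V)
    (hKV : Measurable (K.indicator fun x => ENNReal.ofReal (Real.exp (-V x))))
    [IsFiniteMeasure (gibbsMeasure μ K V)] {g : F → ℝ} (hg : Differentiable ℝ g) {L : NNReal}
    (hL : LipschitzWith L (fderiv ℝ g)) (hg_int : Integrable g (gibbsMeasure μ K V))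
    (hg'_int : MemLp (fderiv ℝ g) 2 (gibbsMeasure μ K V)) :
    pairEnergy (gibbsMeasure μ K V) g
      ≤ ENNReal.ofReal (4 / α) *
        (gibbsMeasure μ K V univ * dirichletEnergy (gibbsMeasure μ K V) g) := by
  set γ := gibbsMeasure μ K V
  set q : F → ℝ := fun x => 2 / α * ‖fderiv ℝ g x‖ ^ 2
  have hg_meas : Measurable g := hg.continuous.measurable
  have : Measurable (fderiv ℝ g) := hL.continuous.measurable
  have hq_int : Integrable q γ := hg'_int.norm.integrable_sq.const_mul _
  have exp_moment : ∀ᶠ ε in 𝓝[>] (0 : ℝ), ∫⁻ p,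
      ENNReal.ofReal (Real.exp (ε * (g p.1 - g p.2) - ε ^ 2 * q p.1)) ∂(γ.prod γ)
        ≤ (γ.prod γ) univ := by
    have small : ∀ᶠ ε in 𝓝 (0 : ℝ), 8 * (ε * L) < α :=
      (by fun_prop : Continuous fun ε : ℝ => 8 * (ε * L)).continuousAt.eventually_lt_const
        (by simpa using hα)
    filter_upwards [self_mem_nhdsWithin, small.filter_mono nhdsWithin_le_nhds] with ε hε hεL
    have maurey := lintegral_exp_mul_lintegral_exp_le (μ := μ) hV hKV
      (u := fun x => ε * g x - ε ^ 2 * q x) (v := fun y => -(ε * g y)) (by fun_prop) (by fun_prop)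
      (perturbation_le_sq_norm_sub hg hL hα (mem_Ioi.1 hε).le hεL.le)
    rw [← lintegral_prod_mul (by fun_prop) (by fun_prop), sq (gibbsMeasure μ K V univ),
      ← Measure.prod_prod, univ_prod_univ] at maurey
    refine (lintegral_congr fun p => ?_).trans_le maurey
    rw [← ENNReal.ofReal_mul (Real.exp_pos _).le, ← Real.exp_add]
    ring_nf
  have second_moment : ∫⁻ p, ENNReal.ofReal ((g p.1 - g p.2) ^ 2 / 2) ∂(γ.prod γ)
      ≤ ENNReal.ofReal (∫ p, q p.1 ∂(γ.prod γ)) :=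
    lintegral_sq_div_two_le_of_lintegral_exp_le (by fun_prop) (by fun_prop)
      ((hg_int.comp_fst γ).sub (hg_int.comp_snd γ)) (hq_int.comp_fst γ)
      (by rw [integral_sub (hg_int.comp_fst γ) (hg_int.comp_snd γ), integral_fun_fst,
        integral_fun_snd, sub_self]) exp_moment
  calc pairEnergy γ g = ∫⁻ p, 2 * ENNReal.ofReal ((g p.1 - g p.2) ^ 2 / 2) ∂(γ.prod γ) := by
        rw [pairEnergy_eq_lintegral_prod hg_meas]
        refine lintegral_congr fun p => ?_
        rw [← enorm_pow, Real.enorm_of_nonneg (sq_nonneg _), ← ENNReal.ofReal_ofNat 2,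
          ← ENNReal.ofReal_mul zero_le_two, mul_div_cancel₀ _ two_ne_zero]
    _ ≤ 2 * ENNReal.ofReal (∫ p, q p.1 ∂(γ.prod γ)) := by
        rw [lintegral_const_mul _ (by fun_prop)]
        gcongr
    _ = ENNReal.ofReal (4 / α) * (γ univ * dirichletEnergy γ g) := by
        rw [dirichletEnergy_eq_ofReal_integral hg'_int, ← ofReal_measureReal,
          ← ENNReal.ofReal_mul (by positivity), ← ENNReal.ofReal_mul (by positivity),
          ← ENNReal.ofReal_ofNat 2, ← ENNReal.ofReal_mul zero_le_two, integral_fun_fst,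
          integral_const_mul, smul_eq_mul]
        ring_nf

end TestFunctions

section Mollification

/-! ### Mollification -/

theorem enorm_integral_sq_le_lintegral_enorm_sq {α G : Type*} [MeasurableSpace α]
    [NormedAddCommGroup G] [NormedSpace ℝ G] {ν : Measure α} [IsProbabilityMeasure ν] {h : α → G}
    (hh : AEStronglyMeasurable h ν) : ‖∫ x, h x ∂ν‖ₑ ^ 2 ≤ ∫⁻ x, ‖h x‖ₑ ^ 2 ∂ν := by
  have lp_two : eLpNorm h 2 ν ^ 2 = ∫⁻ x, ‖h x‖ₑ ^ 2 ∂ν := by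
    simpa using eLpNorm_nnreal_pow_eq_lintegral (f := h) (μ := ν) (p := 2) two_ne_zero
  rw [← lp_two]
  gcongr
  calc ‖∫ x, h x ∂ν‖ₑ ≤ eLpNorm h 1 ν := by
        rw [eLpNorm_one_eq_lintegral_enorm]
        exact enorm_integral_le_lintegral_enorm h
    _ ≤ eLpNorm h 2 ν := eLpNorm_le_eLpNorm_of_exponent_le one_le_two hh

variable {F : Type*} [NormedAddCommGroup F] [NormedSpace ℝ F]

theorem hasLineDerivAt_comp_const_sub {φ : F → ℝ} (hφ : Differentiable ℝ φ) (x u v : F) :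
    HasLineDerivAt ℝ (fun u => φ (x - u)) (-fderiv ℝ φ (x - u) v) u v := by
  simpa [Function.comp_def] using
    ((hφ (x - u)).hasFDerivAt.comp u ((hasFDerivAt_id u).const_sub x)).hasLineDerivAt v

variable [FiniteDimensional ℝ F] [MeasurableSpace F] [BorelSpace F] {μ : Measure F}
  [μ.IsAddHaarMeasure] {φ f : F → ℝ} {f' : F → F →L[ℝ] ℝ}

theorem integral_fderiv_const_sub_mul_eq (hφ : ContDiff ℝ 1 φ) (hφc : HasCompactSupport φ)
    (hf : LocallyIntegrable f μ) (hf' : LocallyIntegrable f' μ) {x : F}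
    (hd : ∀ u, x - u ∈ tsupport φ → HasFDerivAt f (f' u) u) (v : F) :
    ∫ u, fderiv ℝ φ (x - u) v * f u ∂μ = ∫ u, φ (x - u) * f' u v ∂μ := by
  have hf'v : LocallyIntegrable (fun u => f' u v) μ := fun y => by
    obtain ⟨s, hs, hi⟩ := hf' y
    exact ⟨s, hs, hi.apply_continuousLinearMap v⟩
  have integrable_mul {χ h : F → ℝ} (hχ : Continuous χ) (hχc : HasCompactSupport χ)
      (hh : LocallyIntegrable h μ) : Integrable (fun u => χ (x - u) * h u) μ :=
    (hχc.convolutionExists_left (ContinuousLinearMap.mul ℝ ℝ) hχ hh x).integrable_swap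
  have by_parts := integral_bilinear_hasLineDerivAt_right_eq_neg_left_of_integrable
    (μ := μ) (f := fun u => φ (x - u)) (g := f) (v := v)
    (f' := fun u => -fderiv ℝ φ (x - u) v) (g' := fun u => f' u v)
    (B := ContinuousLinearMap.mul ℝ ℝ)
    (by simpa using (integrable_mul ((hφ.continuous_fderiv one_ne_zero).clm_apply continuous_const)
      (hφc.fderiv_apply (𝕜 := ℝ) v) hf).neg)
    (integrable_mul hφ.continuous hφc hf'v) (integrable_mul hφ.continuous hφc hf)
    (fun u _ => hasLineDerivAt_comp_const_sub (hφ.differentiable one_ne_zero) x u v)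
    (fun u hu =>
      (hd u (tsupport_comp_subset_preimage φ (f := (x - ·)) (by fun_prop) hu)).hasLineDerivAt v)
  simpa [integral_neg] using by_parts.symm

theorem fderiv_convolution_eq_integral (hφ : ContDiff ℝ 1 φ) (hφc : HasCompactSupport φ)
    (hf : LocallyIntegrable f μ) (hf' : LocallyIntegrable f' μ) {x : F}
    (hd : ∀ u, x - u ∈ tsupport φ → HasFDerivAt f (f' u) u) :
    fderiv ℝ (φ ⋆[ContinuousLinearMap.lsmul ℝ ℝ, μ] f) x = ∫ u, φ (x - u) • f' u ∂μ := by
  rw [(hφc.hasFDerivAt_convolution_left (ContinuousLinearMap.lsmul ℝ ℝ) hφ hf x).fderiv,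
    convolution_eq_swap]
  ext v
  rw [ContinuousLinearMap.integral_apply, ContinuousLinearMap.integral_apply]
  · exact integral_fderiv_const_sub_mul_eq hφ hφc hf hf' hd v
  · exact (hφc.convolutionExists_left (ContinuousLinearMap.lsmul ℝ ℝ) hφ.continuous hf'
      x).integrable_swap
  · exact ((hφc.fderiv (𝕜 := ℝ)).convolutionExists_left
      ((ContinuousLinearMap.lsmul ℝ ℝ : ℝ →L[ℝ] ℝ →L[ℝ] ℝ).precompL F)
      (hφ.continuous_fderiv one_ne_zero) hf x).integrable_swap

theorem lintegral_ofReal_normed (φ : ContDiffBump (0 : F)) :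
    ∫⁻ u, ENNReal.ofReal (φ.normed μ u) ∂μ = 1 := by
  rw [← ofReal_integral_eq_lintegral_ofReal φ.integrable_normed
    (.of_forall φ.nonneg_normed), φ.integral_normed, ofReal_one]

theorem lintegral_lintegral_normed_sub_mul (φ : ContDiffBump (0 : F)) {b : F → ℝ≥0∞}
    (hb : Measurable b) :
    ∫⁻ x, ∫⁻ u, ENNReal.ofReal (φ.normed μ (x - u)) * b u ∂μ ∂μ = ∫⁻ u, b u ∂μ := by
  have hφ : Continuous (φ.normed μ) := φ.continuous_normed
  rw [lintegral_lintegral_swap (by fun_prop)]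
  refine lintegral_congr fun u => ?_
  rw [lintegral_mul_const _ (by fun_prop),
    lintegral_sub_right_eq_self (fun x => ENNReal.ofReal (φ.normed μ x)) u,
    lintegral_ofReal_normed, one_mul]

theorem enorm_fderiv_normed_convolution_sq_le (φ : ContDiffBump (0 : F))
    (hf : LocallyIntegrable f μ) (hf' : LocallyIntegrable f' μ) {x : F}
    (hd : ∀ u, ‖x - u‖ ≤ φ.rOut → HasFDerivAt f (f' u) u) :
    ‖fderiv ℝ (φ.normed μ ⋆[ContinuousLinearMap.lsmul ℝ ℝ, μ] f) x‖ₑ ^ 2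
      ≤ ∫⁻ u, ENNReal.ofReal (φ.normed μ (x - u)) * ‖f' u‖ₑ ^ 2 ∂μ := by
  have hφ : Continuous (φ.normed μ) := φ.continuous_normed
  rw [fderiv_convolution_eq_integral φ.contDiff_normed φ.hasCompactSupport_normed hf hf'
    fun u hu => hd u (by rwa [φ.tsupport_normed_eq, mem_closedBall_zero_iff] at hu)]
  set w : F → ℝ≥0∞ := fun u => ENNReal.ofReal (φ.normed μ (x - u))
  have hw : Measurable w := by fun_prop
  have hf'_meas : AEStronglyMeasurable f' (μ.withDensity w) :=
    hf'.aestronglyMeasurable.mono_ac (withDensity_absolutelyContinuous _ _)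
  have : IsProbabilityMeasure (μ.withDensity w) := ⟨by
    rw [withDensity_apply _ MeasurableSet.univ, setLIntegral_univ, lintegral_sub_left_eq_self
      (fun u => ENNReal.ofReal (φ.normed μ u)), lintegral_ofReal_normed]⟩
  have jensen := enorm_integral_sq_le_lintegral_enorm_sq hf'_meas
  rw [integral_withDensity_eq_integral_toReal_smul hw (.of_forall fun _ => ofReal_lt_top),
    lintegral_withDensity_eq_lintegral_mul₀ hw.aemeasurable
      (hf'.aestronglyMeasurable.enorm.pow_const 2)] at jensen
  simpa only [w, ENNReal.toReal_ofReal (φ.nonneg_normed _), Pi.mul_apply] using jensen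

theorem exists_contDiffBump_rOut_tendsto_zero (F : Type*) [NormedAddCommGroup F]
    [NormedSpace ℝ F] [HasContDiffBump F] :
    ∃ φ : ℕ → ContDiffBump (0 : F), Tendsto (fun j => (φ j).rOut) atTop (𝓝 0) := by
  have pos (j : ℕ) : (0 : ℝ) < 1 / ((j : ℝ) + 1) := Nat.one_div_pos_of_nat
  exact ⟨fun j => ⟨_, _, half_pos (pos j), half_lt_self (pos j)⟩,
    tendsto_one_div_add_atTop_nhds_zero_nat⟩

end Mollification

section PairEnergy

variable {α : Type*} [MeasurableSpace α] {μ ν : Measure α}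

theorem pairEnergy_mono (h : μ ≤ ν) (f : α → ℝ) : pairEnergy μ f ≤ pairEnergy ν f :=
  lintegral_mono' h fun _ => lintegral_mono' h le_rfl

theorem pairEnergy_smul_measure {c : ℝ≥0∞} (hc : c ≠ ∞) (μ : Measure α) (f : α → ℝ) :
    pairEnergy (c • μ) f = c ^ 2 * pairEnergy μ f := by
  simp only [pairEnergy, lintegral_smul_measure, smul_eq_mul]
  rw [lintegral_const_mul' _ _ hc, ← mul_assoc, sq]

theorem pairEnergy_le_of_tendsto [SFinite μ] {g : ℕ → α → ℝ} {f : α → ℝ} {c : ℝ≥0∞}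
    (hg : ∀ j, Measurable (g j)) (hf : Measurable f)
    (hlim : ∀ᵐ x ∂μ, Tendsto (fun j => g j x) atTop (𝓝 (f x)))
    (hle : ∀ᶠ j in atTop, pairEnergy μ (g j) ≤ c) : pairEnergy μ f ≤ c := by
  rw [pairEnergy_eq_lintegral_prod hf]
  calc ∫⁻ p, ‖f p.1 - f p.2‖ₑ ^ 2 ∂(μ.prod μ)
      = ∫⁻ p, liminf (fun j => ‖g j p.1 - g j p.2‖ₑ ^ 2) atTop ∂(μ.prod μ) := by
        refine lintegral_congr_ae ?_
        filter_upwards [Measure.quasiMeasurePreserving_fst.ae hlim,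
          Measure.quasiMeasurePreserving_snd.ae hlim] with p lim_fst lim_snd
        have cont : Continuous fun t : ℝ => ‖t‖ₑ ^ 2 := by fun_prop
        exact ((cont.tendsto _).comp (lim_fst.sub lim_snd)).liminf_eq.symm
    _ ≤ liminf (fun j => ∫⁻ p, ‖g j p.1 - g j p.2‖ₑ ^ 2 ∂(μ.prod μ)) atTop :=
        lintegral_liminf_le fun j => by fun_prop
    _ ≤ c := liminf_le_of_frequently_le' (hle.mono fun j hj => by
        rwa [← pairEnergy_eq_lintegral_prod (hg j)]).frequently

theorem pairEnergy_restrict_iUnion [SFinite μ] {s : ℕ → Set α} (hs : Monotone s) {f : α → ℝ}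
    (hf : Measurable f) :
    pairEnergy (μ.restrict (⋃ m, s m)) f = ⨆ m, pairEnergy (μ.restrict (s m)) f := by
  have directed : Directed (· ⊆ ·) fun m => s m ×ˢ s m :=
    Monotone.directed_le fun _ _ h => prod_mono (hs h) (hs h)
  simp only [pairEnergy_eq_lintegral_prod hf, Measure.prod_restrict]
  rw [← setLIntegral_iUnion_of_directed _ directed, iUnion_prod_of_monotone hs hs]

end PairEnergy

section Gibbs

variable {F : Type*} [MeasurableSpace F] {μ : Measure F} {K Ω : Set F} {V : F → ℝ}

theorem gibbsMeasure_eq_withDensity_restrict (hK : MeasurableSet K) :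
    gibbsMeasure μ K V
      = (μ.restrict K).withDensity fun x => ENNReal.ofReal (Real.exp (-V x)) :=
  withDensity_indicator hK _

theorem gibbsMeasure_restrict (hK : MeasurableSet K) (hΩ : MeasurableSet Ω) (hKΩ : K ⊆ Ω) :
    (gibbsMeasure μ Ω V).restrict K = gibbsMeasure μ K V := by
  rw [gibbsMeasure_eq_withDensity_restrict hK, gibbsMeasure_eq_withDensity_restrict hΩ,
    restrict_withDensity hK, Measure.restrict_restrict hK, inter_eq_self_of_subset_left hKΩ]

theorem ae_gibbsMeasure_mem (hK : MeasurableSet K) : ∀ᵐ x ∂(gibbsMeasure μ K V), x ∈ K := by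
  rw [← gibbsMeasure_restrict hK hK subset_rfl]
  exact ae_restrict_mem hK

variable [TopologicalSpace F] [BorelSpace F]

theorem measurable_indicator_exp_neg (hK : MeasurableSet K)
    (hV : ContinuousOn V K) :
    Measurable (K.indicator fun x => ENNReal.ofReal (Real.exp (-V x))) := by
  classical
  rw [← piecewise_eq_indicator]
  exact ContinuousOn.measurable_piecewise
    (ENNReal.continuous_ofReal.comp_continuousOn (by fun_prop)) continuousOn_const hK

theorem isFiniteMeasure_gibbsMeasure [T2Space F] [IsFiniteMeasureOnCompacts μ]
    (hK : IsCompact K) (hV : ContinuousOn V K) : IsFiniteMeasure (gibbsMeasure μ K V) := by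
  have integrable : IntegrableOn (fun x => Real.exp (-V x)) K μ :=
    ContinuousOn.integrableOn_compact hK (by fun_prop)
  rw [gibbsMeasure_eq_withDensity_restrict hK.measurableSet]
  exact isFiniteMeasure_withDensity_ofReal integrable.hasFiniteIntegral

theorem exists_restrict_le_smul_gibbsMeasure [T2Space F] (hK : IsCompact K)
    (hV : ContinuousOn V K) : ∃ c : ℝ≥0∞, c ≠ ∞ ∧ μ.restrict K ≤ c • gibbsMeasure μ K V := by
  obtain ⟨M, hM⟩ := hK.exists_bound_of_continuousOn hV
  refine ⟨ENNReal.ofReal (Real.exp M), ofReal_ne_top, ?_⟩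
  rw [gibbsMeasure_eq_withDensity_restrict hK.measurableSet,
    ← withDensity_smul' _ _ ofReal_ne_top]
  refine withDensity_one.symm.trans_le (withDensity_mono ?_)
  refine ae_restrict_of_forall_mem hK.measurableSet fun x hx => ?_
  rw [Pi.smul_apply, smul_eq_mul, ← ENNReal.ofReal_mul (Real.exp_pos _).le, ← Real.exp_add,
    Pi.one_apply, ENNReal.one_le_ofReal, Real.one_le_exp_iff]
  linarith [(Real.le_norm_self _).trans (hM x hx)]

end Gibbs

section OpenConvex

/-! ### The Poincaré inequality on open convex sets -/

variable {F : Type*} [NormedAddCommGroup F] [NormedSpace ℝ F] [FiniteDimensional ℝ F]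
  {K Ω : Set F} {V f : F → ℝ} {α : ℝ}

theorem continuousOn_of_strongConvexOn (hV : StrongConvexOn Ω α V) (hα : 0 ≤ α) (hΩ : IsOpen Ω) :
    ContinuousOn V Ω :=
  (hV.convexOn fun r => by positivity).continuousOn hΩ

variable [MeasurableSpace F] [BorelSpace F] {μ : Measure F}

theorem memLp_fderiv_of_dirichletEnergy_ne_top (hf : dirichletEnergy μ f ≠ ∞) :
    MemLp (fderiv ℝ f) 2 μ := by
  refine ⟨(measurable_fderiv ℝ f).aestronglyMeasurable, ?_⟩
  rw [eLpNorm_lt_top_iff_lintegral_rpow_enorm_lt_top two_ne_zero ofNat_ne_top]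
  simpa [dirichletEnergy] using hf.lt_top

variable [μ.IsAddHaarMeasure]

theorem pairEnergy_le_of_contDiff_of_hasCompactSupport (hα : 0 < α) (hV : StrongConvexOn K α V)
    (hK : IsCompact K) (hVc : ContinuousOn V K) {g : F → ℝ} (hg : ContDiff ℝ 2 g)
    (hgc : HasCompactSupport g) :
    pairEnergy (gibbsMeasure μ K V) g
      ≤ ENNReal.ofReal (4 / α) *
        (gibbsMeasure μ K V univ * dirichletEnergy (gibbsMeasure μ K V) g) := by
  have := isFiniteMeasure_gibbsMeasure (μ := μ) hK hVc
  have hg' : ContDiff ℝ 1 (fderiv ℝ g) := hg.fderiv_right (by norm_num)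
  have hgc' : HasCompactSupport (fderiv ℝ g) := hgc.fderiv (𝕜 := ℝ)
  obtain ⟨L, hL⟩ := hg'.lipschitzWith_of_hasCompactSupport hgc' one_ne_zero
  exact pairEnergy_le_of_lipschitzWith_fderiv hα hV
    (measurable_indicator_exp_neg hK.measurableSet hVc) (hg.differentiable two_ne_zero) hL
    (hg.continuous.integrable_of_hasCompactSupport hgc)
    (hg'.continuous.memLp_of_hasCompactSupport hgc')

theorem dirichletEnergy_normed_convolution_le (φ : ContDiffBump (0 : F)) {f' : F → F →L[ℝ] ℝ}
    {c : ℝ≥0∞} (hK : MeasurableSet K) (hΩ : MeasurableSet Ω) (hVc : ContinuousOn V Ω)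
    (hKΩ : K ⊆ Ω) (hf : LocallyIntegrable f μ) (hf' : LocallyIntegrable f' μ)
    (hf'_meas : Measurable f')
    (hd : ∀ x ∈ K, ∀ u, ‖x - u‖ ≤ φ.rOut → HasFDerivAt f (f' u) u)
    (hc : ∀ x ∈ K, ∀ u, ‖x - u‖ ≤ φ.rOut →
      u ∈ Ω ∧ ENNReal.ofReal (Real.exp (-V x)) ≤ c * ENNReal.ofReal (Real.exp (-V u))) :
    dirichletEnergy (gibbsMeasure μ K V) (φ.normed μ ⋆[ContinuousLinearMap.lsmul ℝ ℝ, μ] f)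
      ≤ c * ∫⁻ u, ‖f' u‖ₑ ^ 2 ∂(gibbsMeasure μ Ω V) := by
  set w : Set F → F → ℝ≥0∞ := fun S => S.indicator fun x => ENNReal.ofReal (Real.exp (-V x))
  have hwK : Measurable (w K) := measurable_indicator_exp_neg hK (hVc.mono hKΩ)
  have hwΩ : Measurable (w Ω) := measurable_indicator_exp_neg hΩ hVc
  set g := φ.normed μ ⋆[ContinuousLinearMap.lsmul ℝ ℝ, μ] f
  have : Measurable (fderiv ℝ g) := measurable_fderiv ℝ g
  have pointwise (x : F) : w K x * ‖fderiv ℝ g x‖ₑ ^ 2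
      ≤ ∫⁻ u, ENNReal.ofReal (φ.normed μ (x - u)) * (c * (w Ω u * ‖f' u‖ₑ ^ 2)) ∂μ := by
    by_cases hx : x ∈ K
    swap
    · simp [w, hx]
    refine (mul_le_mul_right (enorm_fderiv_normed_convolution_sq_le φ hf hf' (hd x hx)) _).trans ?_
    rw [← lintegral_const_mul' _ _ (by simp [w, hx])]
    refine lintegral_mono fun u => ?_
    by_cases hu : ‖x - u‖ ≤ φ.rOut
    · obtain ⟨u_mem, weight_le⟩ := hc x hx u hu
      rw [mul_left_comm, ← mul_assoc c]
      simp only [w, indicator_of_mem hx, indicator_of_mem u_mem]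
      gcongr
    · have : φ.normed μ (x - u) = 0 := Function.notMem_support.1 fun h => hu <| by
        rw [φ.support_normed_eq, mem_ball_zero_iff] at h
        exact h.le
      simp [this]
  calc dirichletEnergy (gibbsMeasure μ K V) g
      = ∫⁻ x, w K x * ‖fderiv ℝ g x‖ₑ ^ 2 ∂μ := by
        rw [dirichletEnergy, gibbsMeasure,
          lintegral_withDensity_eq_lintegral_mul _ hwK (by fun_prop)]
        rfl
    _ ≤ ∫⁻ x, ∫⁻ u, ENNReal.ofReal (φ.normed μ (x - u)) * (c * (w Ω u * ‖f' u‖ₑ ^ 2)) ∂μ ∂μ :=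
        lintegral_mono pointwise
    _ = c * ∫⁻ u, ‖f' u‖ₑ ^ 2 ∂(gibbsMeasure μ Ω V) := by
        rw [lintegral_lintegral_normed_sub_mul φ (by fun_prop), lintegral_const_mul _ (by fun_prop)]
        exact congrArg _ (lintegral_withDensity_eq_lintegral_mul μ hwΩ (by fun_prop)).symm

end OpenConvex

section Exhaustion

variable {F : Type*} [NormedAddCommGroup F] {Ω : Set F}

/-- An exhaustion of an open set by compact subsets, which are convex if the set is. -/
def compactExhaustionOf (Ω : Set F) (m : ℕ) : Set F :=
  Metric.closedBall 0 m ∩ (Metric.thickening (1 / ((m : ℝ) + 1)) Ωᶜ)ᶜ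

theorem mem_compactExhaustionOf {m : ℕ} {x : F} : x ∈ compactExhaustionOf Ω m ↔
    ‖x‖ ≤ m ∧ ∀ z, ‖x - z‖ < 1 / ((m : ℝ) + 1) → z ∈ Ω := by
  simp only [compactExhaustionOf, mem_inter_iff, mem_closedBall_zero_iff, mem_compl_iff,
    Metric.mem_thickening_iff, dist_eq_norm, not_exists, not_and, not_lt]
  refine and_congr_right fun _ => forall_congr' fun z => ?_
  rw [← not_lt, not_imp_not]

theorem compactExhaustionOf_subset (Ω : Set F) (m : ℕ) : compactExhaustionOf Ω m ⊆ Ω :=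
  fun x hx => (mem_compactExhaustionOf.1 hx).2 x (by simpa using Nat.cast_add_one_pos m)

theorem monotone_compactExhaustionOf (Ω : Set F) : Monotone (compactExhaustionOf Ω) := by
  intro m n hmn
  refine inter_subset_inter (Metric.closedBall_subset_closedBall (by exact_mod_cast hmn))
    (compl_subset_compl.2 (Metric.thickening_mono ?_ _))
  gcongr

theorem iUnion_compactExhaustionOf (hΩ : IsOpen Ω) : ⋃ m, compactExhaustionOf Ω m = Ω := by
  refine subset_antisymm (iUnion_subset (compactExhaustionOf_subset Ω)) fun x hx => ?_
  obtain ⟨ε, ε_pos, ball_subset⟩ := Metric.isOpen_iff.1 hΩ x hx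
  obtain ⟨m, hm⟩ := exists_nat_ge ‖x‖
  obtain ⟨n, hn⟩ := exists_nat_one_div_lt ε_pos
  refine mem_iUnion.2 ⟨max m n, mem_compactExhaustionOf.2 ⟨hm.trans ?_, fun z hz => ?_⟩⟩
  · exact_mod_cast le_max_left m n
  · refine ball_subset (mem_ball_iff_norm'.2 ((hz.trans_le ?_).trans hn))
    gcongr
    exact le_max_right m n

variable [NormedSpace ℝ F]

theorem convex_compactExhaustionOf (hΩ : Convex ℝ Ω) (m : ℕ) :
    Convex ℝ (compactExhaustionOf Ω m) := by
  refine (convex_closedBall 0 _).inter fun x hx y hy a b ha hb hab => ?_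
  simp only [mem_compl_iff, Metric.mem_thickening_iff, not_exists, not_and, not_lt,
    dist_eq_norm] at hx hy ⊢
  intro z hz
  by_contra! close
  have shift_mem (w : F) (hw : ∀ z ∈ Ωᶜ, 1 / ((m : ℝ) + 1) ≤ ‖w - z‖) :
      w + (z - (a • x + b • y)) ∈ Ω := by
    by_contra h
    refine (hw _ h).not_gt ?_
    rwa [← norm_neg, neg_sub, add_sub_cancel_left, norm_sub_rev]
  refine hz ?_
  convert hΩ (shift_mem x hx) (shift_mem y hy) ha hb hab using 1
  rw [smul_add, smul_add, add_add_add_comm, ← add_smul, hab, one_smul, add_sub_cancel]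

theorem isCompact_compactExhaustionOf [FiniteDimensional ℝ F] (Ω : Set F) (m : ℕ) :
    IsCompact (compactExhaustionOf Ω m) :=
  (isCompact_closedBall 0 _).inter_right Metric.isOpen_thickening.isClosed_compl

end Exhaustion

/-- Cutting `f` off outside `K` makes the mollification global; a point of `K` and its neighbours
at distance less than `δ` do not see the cut. -/
theorem indicator_eventuallyEq_of_cthickening_subset {F : Type*} [NormedAddCommGroup F]
    {K S : Set F} {f : F → ℝ} {δ : ℝ} (hS : Metric.cthickening δ K ⊆ S) {x u : F} (hx : x ∈ K)
    (hu : ‖x - u‖ < δ) :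
    u ∈ S ∧ S.indicator f =ᶠ[𝓝 u] f := by
  have ball_subset : Metric.ball x δ ⊆ S :=
    ((Metric.ball_subset_thickening hx δ).trans (Metric.thickening_subset_cthickening δ K)).trans hS
  have u_mem : u ∈ Metric.ball x δ := by rwa [mem_ball_iff_norm']
  exact ⟨ball_subset u_mem, eventually_of_mem (Metric.isOpen_ball.mem_nhds u_mem) fun z hz =>
    indicator_of_mem (ball_subset hz) f⟩

theorem ofReal_exp_neg_le_exp_mul {a b η : ℝ} (h : |a - b| ≤ η) :
    ENNReal.ofReal (Real.exp (-a))
      ≤ ENNReal.ofReal (Real.exp η) * ENNReal.ofReal (Real.exp (-b)) := by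
  rw [← ENNReal.ofReal_mul (Real.exp_pos _).le, ← Real.exp_add]
  refine ENNReal.ofReal_le_ofReal (Real.exp_le_exp.2 ?_)
  linarith [(abs_le.1 h).1]

section OpenConvex

variable {F : Type*} [NormedAddCommGroup F] [NormedSpace ℝ F] {K Ω : Set F} {V f : F → ℝ} {α : ℝ}
variable [MeasurableSpace F] [BorelSpace F] {μ : Measure F}
variable [μ.IsAddHaarMeasure]

theorem integrable_indicator_fderiv (hK : IsCompact K) (hΩ : MeasurableSet Ω) (hKΩ : K ⊆ Ω)
    (hV : ContinuousOn V Ω) (hf : MemLp (fderiv ℝ f) 2 (gibbsMeasure μ Ω V)) :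
    Integrable (K.indicator (fderiv ℝ f)) μ := by
  obtain ⟨c, c_ne_top, restrict_le⟩ :=
    exists_restrict_le_smul_gibbsMeasure (μ := μ) hK (hV.mono hKΩ)
  rw [← gibbsMeasure_restrict hK.measurableSet hΩ hKΩ] at restrict_le
  have : IsFiniteMeasure (μ.restrict K) := ⟨by simpa using hK.measure_lt_top⟩
  have integrableOn : IntegrableOn (fderiv ℝ f) K μ :=
    (((hf.restrict K).smul_measure c_ne_top).mono_measure restrict_le).integrable one_le_two
  exact IntegrableOn.integrable_indicator (f := fderiv ℝ f) integrableOn hK.measurableSet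

variable [FiniteDimensional ℝ F]

theorem exists_contDiff_seq_dirichletEnergy_le (hK : IsCompact K) (hΩ : IsOpen Ω) (hKΩ : K ⊆ Ω)
    (hV : ContinuousOn V Ω) (hf : ∀ x ∈ Ω, DifferentiableAt ℝ f x)
    (hf' : MemLp (fderiv ℝ f) 2 (gibbsMeasure μ Ω V)) :
    ∃ g : ℕ → F → ℝ, (∀ j, ContDiff ℝ 2 (g j)) ∧ (∀ j, HasCompactSupport (g j)) ∧
      (∀ x ∈ K, Tendsto (fun j => g j x) atTop (𝓝 (f x))) ∧
      ∀ η > 0, ∀ᶠ j in atTop, dirichletEnergy (gibbsMeasure μ K V) (g j)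
        ≤ ENNReal.ofReal (Real.exp η) * dirichletEnergy (gibbsMeasure μ Ω V) f := by
  obtain ⟨δ, δ_pos, hδ⟩ := hK.exists_cthickening_subset_open hΩ hKΩ
  set S := Metric.cthickening δ K
  have compact_S : IsCompact S := hK.cthickening
  have f_int : Integrable (S.indicator f) μ :=
    (ContinuousOn.integrableOn_compact compact_S fun x hx =>
      (hf x (hδ hx)).continuousAt.continuousWithinAt).integrable_indicator compact_S.measurableSet
  have f'_int := integrable_indicator_fderiv compact_S hΩ.measurableSet hδ hV hf'
  have f'_meas : Measurable (S.indicator (fderiv ℝ f)) :=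
    (measurable_fderiv ℝ f).indicator compact_S.measurableSet
  have near {x u : F} := indicator_eventuallyEq_of_cthickening_subset (f := f) (x := x) (u := u)
    (subset_refl S)
  obtain ⟨φ, hφ⟩ := exists_contDiffBump_rOut_tendsto_zero F
  refine ⟨fun j => (φ j).normed μ ⋆[ContinuousLinearMap.lsmul ℝ ℝ, μ] S.indicator f,
    fun j => ?_, fun j => ?_, fun x hx => ?_, fun η η_pos => ?_⟩
  · exact (φ j).hasCompactSupport_normed.contDiff_convolution_left (n := 2) _
      (φ j).contDiff_normed f_int.locallyIntegrable
  · exact HasCompactSupport.convolution _ (φ j).hasCompactSupport_normed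
      (HasCompactSupport.intro compact_S fun x hx => indicator_of_notMem hx f)
  · obtain ⟨x_mem, eq_near⟩ := near (u := x) hx (by simpa using δ_pos)
    refine ContDiffBump.convolution_tendsto_right hφ
      (.of_forall fun _ => f_int.aestronglyMeasurable) ?_ tendsto_const_nhds
    exact ((hf x (hδ x_mem)).continuousAt.tendsto.congr' eq_near.symm).comp tendsto_snd
  · obtain ⟨δ', δ'_pos, hδ'⟩ := Metric.uniformContinuousOn_iff_le.1
      (compact_S.uniformContinuousOn_of_continuous (hV.mono hδ)) η η_pos
    filter_upwards [hφ.eventually_lt_const (lt_min δ_pos δ'_pos)] with j hj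
    refine (dirichletEnergy_normed_convolution_le (Ω := Ω) (c := ENNReal.ofReal (Real.exp η)) (φ j)
      hK.measurableSet hΩ.measurableSet hV hKΩ f_int.locallyIntegrable f'_int.locallyIntegrable
      f'_meas (fun x hx u hu => ?_) fun x hx u hu => ?_).trans (mul_le_mul_right ?_ _)
    · obtain ⟨u_mem, eq_near⟩ := near hx ((hu.trans_lt hj).trans_le (min_le_left _ _))
      rw [indicator_of_mem u_mem]
      exact (hf u (hδ u_mem)).hasFDerivAt.congr_of_eventuallyEq eq_near
    · have u_mem : u ∈ S := (near hx ((hu.trans_lt hj).trans_le (min_le_left _ _))).1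
      have dist_le : dist x u ≤ δ' := by
        rw [dist_eq_norm]
        exact (hu.trans hj.le).trans (min_le_right _ _)
      exact ⟨hδ u_mem, ofReal_exp_neg_le_exp_mul
        (hδ' x (Metric.self_subset_cthickening K hx) u u_mem dist_le)⟩
    · exact lintegral_mono fun u => by
        gcongr
        exact enorm_le_iff_norm_le.2 (norm_indicator_le_norm_self _ _)

theorem pairEnergy_le_of_isCompact (hα : 0 < α) (hV : StrongConvexOn Ω α V) (hΩ : IsOpen Ω)
    (hK : IsCompact K) (hK_convex : Convex ℝ K) (hKΩ : K ⊆ Ω) (hf : Measurable f)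
    (hfd : ∀ x ∈ Ω, DifferentiableAt ℝ f x) (hf' : MemLp (fderiv ℝ f) 2 (gibbsMeasure μ Ω V)) :
    pairEnergy (gibbsMeasure μ K V) f
      ≤ ENNReal.ofReal (4 / α) *
        (gibbsMeasure μ K V univ * dirichletEnergy (gibbsMeasure μ Ω V) f) := by
  have V_cont : ContinuousOn V Ω := continuousOn_of_strongConvexOn hV hα.le hΩ
  have hVK : StrongConvexOn K α V := ⟨hK_convex, fun _ hx _ hy => hV.2 (hKΩ hx) (hKΩ hy)⟩
  have finite := isFiniteMeasure_gibbsMeasure (μ := μ) hK (V_cont.mono hKΩ)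
  obtain ⟨g, g_smooth, g_supp, g_lim, g_energy⟩ :=
    exists_contDiff_seq_dirichletEnergy_le hK hΩ hKΩ V_cont hfd hf'
  have upTo (η : ℝ) (hη : 0 < η) : pairEnergy (gibbsMeasure μ K V) f
      ≤ ENNReal.ofReal (4 / α) * (gibbsMeasure μ K V univ *
        (ENNReal.ofReal (Real.exp η) * dirichletEnergy (gibbsMeasure μ Ω V) f)) := by
    refine pairEnergy_le_of_tendsto (fun j => (g_smooth j).continuous.measurable) hf
      ((ae_gibbsMeasure_mem hK.measurableSet).mono g_lim) ?_
    filter_upwards [g_energy η hη] with j hj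
    refine (pairEnergy_le_of_contDiff_of_hasCompactSupport hα hVK hK (V_cont.mono hKΩ)
      (g_smooth j) (g_supp j)).trans ?_
    gcongr
  have lim : Tendsto (fun η => ENNReal.ofReal (4 / α) * (gibbsMeasure μ K V univ *
      (ENNReal.ofReal (Real.exp η) * dirichletEnergy (gibbsMeasure μ Ω V) f))) (𝓝[>] 0)
      (𝓝 (ENNReal.ofReal (4 / α) * (gibbsMeasure μ K V univ *
        (ENNReal.ofReal (Real.exp 0) * dirichletEnergy (gibbsMeasure μ Ω V) f)))) := by
    refine tendsto_nhdsWithin_of_tendsto_nhds ?_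
    refine ENNReal.Tendsto.const_mul (ENNReal.Tendsto.const_mul (ENNReal.Tendsto.mul_const
      (ENNReal.tendsto_ofReal (Real.continuous_exp.tendsto 0)) (.inl ?_))
      (.inr (measure_ne_top _ _))) (.inr ofReal_ne_top)
    simp
  simpa using ge_of_tendsto lim (eventually_of_mem self_mem_nhdsWithin upTo)

theorem pairEnergy_gibbsMeasure_le (hα : 0 < α) (hV : StrongConvexOn Ω α V) (hΩ : IsOpen Ω)
    (hf : Measurable f) (hfd : ∀ x ∈ Ω, DifferentiableAt ℝ f x) :
    pairEnergy (gibbsMeasure μ Ω V) f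
      ≤ ENNReal.ofReal (4 / α) *
        (gibbsMeasure μ Ω V univ * dirichletEnergy (gibbsMeasure μ Ω V) f) := by
  set γ := gibbsMeasure μ Ω V with hγ
  have : SFinite γ := by rw [hγ, gibbsMeasure]; infer_instance
  rcases eq_or_ne (γ univ) 0 with mass_zero | mass_ne_zero
  · simp [Measure.measure_univ_eq_zero.1 mass_zero, pairEnergy]
  rcases eq_or_ne (dirichletEnergy γ f) ∞ with infinite | finite
  · rw [infinite, ENNReal.mul_top mass_ne_zero, ENNReal.mul_top (by simpa using hα)]
    exact le_top
  have restrict_eq (m : ℕ) :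
      γ.restrict (compactExhaustionOf Ω m) = gibbsMeasure μ (compactExhaustionOf Ω m) V :=
    gibbsMeasure_restrict (isCompact_compactExhaustionOf Ω m).measurableSet hΩ.measurableSet
      (compactExhaustionOf_subset Ω m)
  calc pairEnergy γ f = pairEnergy (γ.restrict (⋃ m, compactExhaustionOf Ω m)) f := by
        rw [iUnion_compactExhaustionOf hΩ,
          gibbsMeasure_restrict hΩ.measurableSet hΩ.measurableSet subset_rfl]
    _ = ⨆ m, pairEnergy (γ.restrict (compactExhaustionOf Ω m)) f :=
        pairEnergy_restrict_iUnion (monotone_compactExhaustionOf Ω) hf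
    _ ≤ ENNReal.ofReal (4 / α) * (γ univ * dirichletEnergy γ f) := iSup_le fun m => by
        have mass_le : γ.restrict (compactExhaustionOf Ω m) univ ≤ γ univ :=
          Measure.restrict_apply_le _ _
        rw [restrict_eq] at mass_le ⊢
        refine (pairEnergy_le_of_isCompact hα hV hΩ (isCompact_compactExhaustionOf Ω m)
          (convex_compactExhaustionOf hV.1 m) (compactExhaustionOf_subset Ω m) hf hfd
          (memLp_fderiv_of_dirichletEnergy_ne_top finite)).trans ?_
        gcongr

/-- The perturbation argument of Holley and Stroock. -/
theorem pairEnergy_le_of_comparable {w : F → ℝ} {c C : ℝ} (hα : 0 < α)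
    (hV : StrongConvexOn Ω α V) (hΩ : IsOpen Ω) (hc : 0 < c)
    (hcw : ∀ x ∈ Ω, c * Real.exp (-V x) ≤ w x) (hwC : ∀ x ∈ Ω, w x ≤ C * Real.exp (-V x))
    (hmem : ∀ᵐ x ∂(μ.withDensity fun x => ENNReal.ofReal (w x)), x ∈ Ω)
    (hf : Measurable f) (hfd : ∀ x ∈ Ω, DifferentiableAt ℝ f x) :
    pairEnergy (μ.withDensity fun x => ENNReal.ofReal (w x)) f
      ≤ ENNReal.ofReal (C / c) ^ 2 * ENNReal.ofReal (4 / α) *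
        (μ.withDensity (fun x => ENNReal.ofReal (w x)) univ *
          dirichletEnergy (μ.withDensity fun x => ENNReal.ofReal (w x)) f) := by
  set ν := μ.withDensity fun x => ENNReal.ofReal (w x) with hν
  set γ := gibbsMeasure μ Ω V with hγ
  have ν_eq : ν = (μ.restrict Ω).withDensity fun x => ENNReal.ofReal (w x) := by
    rw [← Measure.restrict_eq_self_of_ae_mem hmem, hν, restrict_withDensity hΩ.measurableSet]
  have ν_le : ν ≤ ENNReal.ofReal C • γ := by
    rw [ν_eq, hγ, gibbsMeasure_eq_withDensity_restrict hΩ.measurableSet,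
      ← withDensity_smul' _ _ ofReal_ne_top]
    refine withDensity_mono (ae_restrict_of_forall_mem hΩ.measurableSet fun x hx => ?_)
    rw [Pi.smul_apply, smul_eq_mul, ← ENNReal.ofReal_mul' (Real.exp_pos _).le]
    exact ENNReal.ofReal_le_ofReal (hwC x hx)
  have γ_le : γ ≤ ENNReal.ofReal c⁻¹ • ν := by
    rw [ν_eq, hγ, gibbsMeasure_eq_withDensity_restrict hΩ.measurableSet,
      ← withDensity_smul' _ _ ofReal_ne_top]
    refine withDensity_mono (ae_restrict_of_forall_mem hΩ.measurableSet fun x hx => ?_)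
    rw [Pi.smul_apply, smul_eq_mul, ← ENNReal.ofReal_mul (inv_pos.2 hc).le]
    refine ENNReal.ofReal_le_ofReal ?_
    rw [inv_mul_eq_div, le_div_iff₀' hc]
    exact hcw x hx
  calc pairEnergy ν f ≤ ENNReal.ofReal C ^ 2 * pairEnergy γ f := by
        rw [← pairEnergy_smul_measure ofReal_ne_top]
        exact pairEnergy_mono ν_le f
    _ ≤ ENNReal.ofReal C ^ 2 * (ENNReal.ofReal (4 / α) * (γ univ * dirichletEnergy γ f)) := by
        gcongr
        exact pairEnergy_gibbsMeasure_le hα hV hΩ hf hfd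
    _ ≤ ENNReal.ofReal C ^ 2 * (ENNReal.ofReal (4 / α) * ((ENNReal.ofReal c⁻¹ • ν) univ *
          dirichletEnergy (ENNReal.ofReal c⁻¹ • ν) f)) := by
        gcongr
        exact lintegral_mono' γ_le le_rfl
    _ = ENNReal.ofReal (C / c) ^ 2 * ENNReal.ofReal (4 / α) * (ν univ * dirichletEnergy ν f) := by
        rw [dirichletEnergy, lintegral_smul_measure, Measure.smul_apply, smul_eq_mul, smul_eq_mul,
          ← dirichletEnergy, div_eq_mul_inv C c, ENNReal.ofReal_mul' (inv_pos.2 hc).le]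
        ring

end OpenConvex

section Orthogonal

variable {D : ℕ} {W : Matrix (Fin D) (Fin D) ℝ}

/-- The isometry of `ℝᴰ` given by an orthogonal matrix. -/
def orthogonalIsometry (hW : W ∈ Matrix.orthogonalGroup (Fin D) ℝ) : E D ≃ₗᵢ[ℝ] E D :=
  Unitary.linearIsometryEquiv
    ⟨Matrix.toEuclideanCLM (n := Fin D) (𝕜 := ℝ) W, Unitary.map_mem _ hW⟩

theorem orthogonalIsometry_apply (hW : W ∈ Matrix.orthogonalGroup (Fin D) ℝ) (x : E D) :
    orthogonalIsometry hW x = Matrix.toEuclideanCLM (n := Fin D) (𝕜 := ℝ) W x :=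
  rfl

theorem norm_toEuclideanCLM_le_one (hW : W ∈ Matrix.orthogonalGroup (Fin D) ℝ) :
    ‖Matrix.toEuclideanCLM (n := Fin D) (𝕜 := ℝ) W‖ ≤ 1 :=
  (orthogonalIsometry hW).toLinearIsometry.norm_toContinuousLinearMap_le

/-- The columns of an orthogonal matrix. -/
def columnBasis (hW : W ∈ Matrix.orthogonalGroup (Fin D) ℝ) : OrthonormalBasis (Fin D) ℝ (E D) :=
  (EuclideanSpace.basisFun (Fin D) ℝ).map (orthogonalIsometry hW)

theorem columnBasis_apply (hW : W ∈ Matrix.orthogonalGroup (Fin D) ℝ) (i : Fin D) :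
    columnBasis hW i
      = Matrix.toEuclideanCLM (n := Fin D) (𝕜 := ℝ) W (EuclideanSpace.single i 1) := by
  simp [columnBasis, orthogonalIsometry_apply]

theorem inner_columnBasis (hW : W ∈ Matrix.orthogonalGroup (Fin D) ℝ) (i : Fin D) (x : E D) :
    inner ℝ (columnBasis hW i) x = ∑ a, W a i * x a := by
  rw [columnBasis_apply]
  simp [PiLp.inner_apply, Matrix.ofLp_toEuclideanCLM, mul_comm]

end Orthogonal

section Splitting

variable {D d : ℕ} (hd : d < D) {W : Matrix (Fin D) (Fin D) ℝ}

/-- The isometry assembling a point of `ℝᴰ` from its first `d` and its last `D - d` coordinates. -/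
def joinCoords : WithLp 2 (E d × E (D - d)) ≃ₗᵢ[ℝ] E D :=
  (PiLp.sumPiLpEquivProdLpPiLp (𝕜 := ℝ) 2 fun _ => ℝ).symm.trans
    (LinearIsometryEquiv.piLpCongrLeft 2 ℝ ℝ
      (finSumFinEquiv.trans (finCongr (Nat.add_sub_cancel' hd.le))))

theorem joinCoords_apply_active (y : E d) (z : E (D - d)) (i : Fin d) :
    joinCoords hd (WithLp.toLp 2 (y, z)) (Fin.castLE hd.le i) = y i := by
  have symm_apply : (finSumFinEquiv.trans (finCongr (Nat.add_sub_cancel' hd.le))).symm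
      (Fin.castLE hd.le i) = Sum.inl i := finSumFinEquiv_symm_apply_castAdd i
  change (Sum.rec y.ofLp z.ofLp ((finSumFinEquiv.trans _).symm _) : ℝ) = y i
  rw [symm_apply]

theorem joinCoords_apply_inactive (y : E d) (z : E (D - d)) (j : Fin (D - d)) :
    joinCoords hd (WithLp.toLp 2 (y, z)) ⟨d + j, by omega⟩ = z j := by
  have symm_apply : (finSumFinEquiv.trans (finCongr (Nat.add_sub_cancel' hd.le))).symm
      ⟨d + j, by omega⟩ = Sum.inr j := finSumFinEquiv_symm_apply_natAdd j
  change (Sum.rec y.ofLp z.ofLp ((finSumFinEquiv.trans _).symm _) : ℝ) = z j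
  rw [symm_apply]

theorem recombine_eq_toEuclideanCLM (y : E d) (z : E (D - d)) :
    recombine hd W y z
      = Matrix.toEuclideanCLM (n := Fin D) (𝕜 := ℝ) W (joinCoords hd (WithLp.toLp 2 (y, z))) := by
  ext a
  change (∑ i, W a (Fin.castLE hd.le i) * y i) + (∑ j : Fin (D - d), W a ⟨d + j, by omega⟩ * z j)
    = ∑ b, W a b * joinCoords hd (WithLp.toLp 2 (y, z)) b
  rw [← (finSumFinEquiv.trans (finCongr (Nat.add_sub_cancel' hd.le))).sum_comp,
    Fintype.sum_sum_type]
  congr 1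
  · exact Finset.sum_congr rfl fun i _ =>
      congrArg (W a (Fin.castLE hd.le i) * ·) (joinCoords_apply_active hd y z i).symm
  · exact Finset.sum_congr rfl fun j _ =>
      congrArg (W a ⟨d + j, by omega⟩ * ·) (joinCoords_apply_inactive hd y z j).symm

theorem activeVar_recombine (hW : W ∈ Matrix.orthogonalGroup (Fin D) ℝ) (y : E d)
    (z : E (D - d)) : activeVar hd W (recombine hd W y z) = y := by
  ext i
  have transpose_mul : W.transpose * W = 1 := (Matrix.mem_orthogonalGroup_iff' _ _).1 hW
  change (W.transpose.mulVec (recombine hd W y z).ofLp) (Fin.castLE hd.le i) = y i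
  rw [recombine_eq_toEuclideanCLM, Matrix.ofLp_toEuclideanCLM, Matrix.mulVec_mulVec, transpose_mul,
    Matrix.one_mulVec, joinCoords_apply_active]

theorem measurePreserving_recombine (hW : W ∈ Matrix.orthogonalGroup (Fin D) ℝ) :
    MeasurePreserving fun p : E d × E (D - d) => recombine hd W p.1 p.2 := by
  simp_rw [recombine_eq_toEuclideanCLM]
  exact (orthogonalIsometry hW).measurePreserving.comp
    ((joinCoords hd).measurePreserving.comp (WithLp.volume_preserving_toLp _ _))

/-- The linear map `z ↦ W₂ z`. -/
def inactiveMap (W : Matrix (Fin D) (Fin D) ℝ) : E (D - d) →L[ℝ] E D :=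
  (Matrix.toEuclideanLin (inactiveBlock hd W)).toContinuousLinearMap

theorem recombine_eq_add_inactiveMap (y : E d) (z : E (D - d)) :
    recombine hd W y z = recombine hd W y 0 + inactiveMap hd W z := by
  ext a
  simp [recombine, inactiveMap, Matrix.toLpLin_apply]

theorem inactiveMap_apply_eq_toEuclideanCLM (W : Matrix (Fin D) (Fin D) ℝ) (z : E (D - d)) :
    inactiveMap hd W z
      = Matrix.toEuclideanCLM (n := Fin D) (𝕜 := ℝ) W (joinCoords hd (WithLp.toLp 2 (0, z))) := by
  rw [← recombine_eq_toEuclideanCLM]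
  ext a
  simp [recombine, inactiveMap, Matrix.toLpLin_apply]

theorem norm_inactiveMap_le (W : Matrix (Fin D) (Fin D) ℝ) :
    ‖inactiveMap hd W‖ ≤ ‖Matrix.toEuclideanCLM (n := Fin D) (𝕜 := ℝ) W‖ := by
  refine ContinuousLinearMap.opNorm_le_bound _ (norm_nonneg _) fun z => ?_
  rw [inactiveMap_apply_eq_toEuclideanCLM]
  refine (ContinuousLinearMap.le_opNorm _ _).trans_eq ?_
  rw [LinearIsometryEquiv.norm_map, WithLp.norm_toLp_snd]

theorem norm_inactiveMap_apply (hW : W ∈ Matrix.orthogonalGroup (Fin D) ℝ) (z : E (D - d)) :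
    ‖inactiveMap hd W z‖ = ‖z‖ := by
  rw [inactiveMap_apply_eq_toEuclideanCLM, ← orthogonalIsometry_apply hW,
    LinearIsometryEquiv.norm_map, LinearIsometryEquiv.norm_map, WithLp.norm_toLp_snd]

/-- The affine isometry `z ↦ W₁ y + W₂ z` onto the fiber of `activeVar` over `y`. -/
def fiberIsometry (hW : W ∈ Matrix.orthogonalGroup (Fin D) ℝ) (y : E d) :
    E (D - d) →ᵃⁱ[ℝ] E D where
  toFun := recombine hd W y
  linear := (inactiveMap hd W).toLinearMap
  map_vadd' z v := by
    simp only [vadd_eq_add, ContinuousLinearMap.coe_coe]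
    rw [recombine_eq_add_inactiveMap, map_add, recombine_eq_add_inactiveMap hd y z]
    abel
  norm_map := norm_inactiveMap_apply hd hW

/-- The linear map `x ↦ W₂ᵀ x`. -/
def inactiveVar (W : Matrix (Fin D) (Fin D) ℝ) : E D →L[ℝ] E (D - d) :=
  ContinuousLinearMap.adjoint (inactiveMap hd W)

theorem norm_inactiveVar_le (W : Matrix (Fin D) (Fin D) ℝ) :
    ‖inactiveVar hd W‖ ≤ ‖Matrix.toEuclideanCLM (n := Fin D) (𝕜 := ℝ) W‖ :=
  (LinearIsometryEquiv.norm_map _ _).trans_le (norm_inactiveMap_le hd W)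

theorem inactiveVar_sub (A B : Matrix (Fin D) (Fin D) ℝ) :
    inactiveVar hd (A - B) = inactiveVar hd A - inactiveVar hd B := by
  have : inactiveMap hd (A - B) = inactiveMap hd A - inactiveMap hd B := by
    ext1 z
    simp only [inactiveMap_apply_eq_toEuclideanCLM, map_sub, sub_apply]
  rw [inactiveVar, this, map_sub, inactiveVar, inactiveVar]

theorem inactiveVar_columnBasis (hW : W ∈ Matrix.orthogonalGroup (Fin D) ℝ) {i : Fin D}
    (hi : i.val < d) : inactiveVar hd W (columnBasis hW i) = 0 := by
  refine ext_inner_right ℝ fun z => ?_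
  rw [inactiveVar, ContinuousLinearMap.adjoint_inner_left, inactiveMap_apply_eq_toEuclideanCLM,
    columnBasis_apply, ← orthogonalIsometry_apply hW, ← orthogonalIsometry_apply hW,
    LinearIsometryEquiv.inner_map_map, EuclideanSpace.inner_single_left, inner_zero_left]
  simpa using joinCoords_apply_active hd 0 z ⟨i, hi⟩

theorem norm_inactiveVar_columnBasis_le_one {Wc : Matrix (Fin D) (Fin D) ℝ}
    (hW : W ∈ Matrix.orthogonalGroup (Fin D) ℝ) (hWc : Wc ∈ Matrix.orthogonalGroup (Fin D) ℝ)
    (i : Fin D) : ‖inactiveVar hd Wc (columnBasis hW i)‖ ≤ 1 := by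
  simpa using (inactiveVar hd Wc).le_of_opNorm_le
    ((norm_inactiveVar_le hd Wc).trans (norm_toEuclideanCLM_le_one hWc)) (columnBasis hW i)

theorem norm_inactiveVar_columnBasis_le {Wc : Matrix (Fin D) (Fin D) ℝ}
    (hW : W ∈ Matrix.orthogonalGroup (Fin D) ℝ) {i : Fin D} (hi : i.val < d) :
    ‖inactiveVar hd Wc (columnBasis hW i)‖
      ≤ ‖Matrix.toEuclideanCLM (n := Fin D) (𝕜 := ℝ) (W - Wc)‖ := by
  have eq_neg : inactiveVar hd Wc (columnBasis hW i)
      = -inactiveVar hd (W - Wc) (columnBasis hW i) := by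
    rw [inactiveVar_sub, sub_apply, inactiveVar_columnBasis hd hW hi, zero_sub,
      neg_neg]
  rw [eq_neg, norm_neg]
  simpa using (inactiveVar hd (W - Wc)).le_of_opNorm_le (norm_inactiveVar_le hd _)
    (columnBasis hW i)

end Splitting

section PrincipalComponents

variable {D : ℕ} {𝓧 : Type*} {m𝓧 : MeasurableSpace 𝓧} {μ : Measure 𝓧} {g : 𝓧 → E D}
  {W : Matrix (Fin D) (Fin D) ℝ} {lam : Fin D → ℝ}

/-- The matrix `∫ g ⊗ g dμ` of second moments of a random vector `g`; the matrix
`gradientCovariance ρ f` is the case of `gradient f`. -/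
def secondMomentMatrix (μ : Measure 𝓧) (g : 𝓧 → E D) : Matrix (Fin D) (Fin D) ℝ :=
  Matrix.of fun i j => ∫ x, g x i * g x j ∂μ

theorem integral_inner_columnBasis_mul (hg : MemLp g 2 μ)
    (hW : IsEigendecomposition (secondMomentMatrix μ g) W lam) (i j : Fin D) :
    ∫ x, inner ℝ (columnBasis hW.orthogonal i) (g x) * inner ℝ (columnBasis hW.orthogonal j) (g x)
      ∂μ = Matrix.diagonal lam i j := by
  have memLp_apply (a : Fin D) : MemLp (fun x => g x a) 2 μ :=
    (EuclideanSpace.proj (𝕜 := ℝ) a).comp_memLp' hg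
  have integrable (a b : Fin D) : Integrable (fun x => g x a * g x b) μ :=
    (memLp_apply a).integrable_mul (memLp_apply b)
  have transpose_mul : W.transpose * W = 1 :=
    (Matrix.mem_orthogonalGroup_iff' _ _).1 hW.orthogonal
  have conjugate : W.transpose * secondMomentMatrix μ g * W = Matrix.diagonal lam := by
    rw [hW.eq_mul, ← mul_assoc, ← mul_assoc, transpose_mul, one_mul, mul_assoc, transpose_mul,
      mul_one]
  have expand (x : 𝓧) :
      inner ℝ (columnBasis hW.orthogonal i) (g x) * inner ℝ (columnBasis hW.orthogonal j) (g x)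
        = ∑ b, ∑ a, W a i * W b j * (g x a * g x b) := by
    rw [inner_columnBasis, inner_columnBasis, Finset.sum_mul_sum, Finset.sum_comm]
    exact Finset.sum_congr rfl fun b _ => Finset.sum_congr rfl fun a _ => by ring
  simp_rw [expand]
  rw [integral_finsetSum _ fun b _ => integrable_finsetSum _ fun a _ =>
    (integrable a b).const_mul _, ← conjugate]
  simp_rw [integral_finsetSum _ fun a _ => (integrable a _).const_mul _, integral_const_mul,
    Matrix.mul_apply, Finset.sum_mul]
  refine Finset.sum_congr rfl fun b _ => Finset.sum_congr rfl fun a _ => ?_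
  rw [secondMomentMatrix, Matrix.of_apply, Matrix.transpose_apply]
  ring

theorem eigenvalue_nonneg (hg : MemLp g 2 μ)
    (hW : IsEigendecomposition (secondMomentMatrix μ g) W lam) (i : Fin D) : 0 ≤ lam i := by
  rw [← Matrix.diagonal_apply_eq lam i, ← integral_inner_columnBasis_mul hg hW i i]
  exact integral_nonneg fun x => mul_self_nonneg _

/-- Expand `g` in the eigenvectors: its coefficients are uncorrelated, so only the diagonal terms
of the square survive integration. -/
theorem lintegral_enorm_map_sq_eq {G : Type*} [NormedAddCommGroup G] [InnerProductSpace ℝ G]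
    (T : E D →L[ℝ] G) (hg : MemLp g 2 μ)
    (hW : IsEigendecomposition (secondMomentMatrix μ g) W lam) :
    ∫⁻ x, ‖T (g x)‖ₑ ^ 2 ∂μ
      = ENNReal.ofReal (∑ i, lam i * ‖T (columnBasis hW.orthogonal i)‖ ^ 2) := by
  set w := columnBasis hW.orthogonal
  have memLp_inner (i : Fin D) : MemLp (fun x => inner ℝ (w i) (g x)) 2 μ :=
    hg.const_inner (𝕜 := ℝ) (w i)
  have expand (x : 𝓧) : ‖T (g x)‖ ^ 2 = ∑ i, ∑ j,
      inner ℝ (T (w i)) (T (w j)) * (inner ℝ (w i) (g x) * inner ℝ (w j) (g x)) := by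
    have T_expand : T (g x) = ∑ i, inner ℝ (w i) (g x) • T (w i) := by
      conv_lhs => rw [← w.sum_repr' (g x), map_sum]
      simp only [map_smul]
    rw [← real_inner_self_eq_norm_sq, T_expand, sum_inner]
    refine Finset.sum_congr rfl fun i _ => ?_
    rw [inner_sum]
    refine Finset.sum_congr rfl fun j _ => ?_
    rw [real_inner_smul_left, real_inner_smul_right]
    ring
  have integrable (i j : Fin D) : Integrable (fun x => inner ℝ (T (w i)) (T (w j)) *
      (inner ℝ (w i) (g x) * inner ℝ (w j) (g x))) μ :=
    ((memLp_inner i).integrable_mul (memLp_inner j)).const_mul _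
  have integrable_norm_sq : Integrable (fun x => ‖T (g x)‖ ^ 2) μ :=
    (T.comp_memLp' hg).norm.integrable_sq
  calc ∫⁻ x, ‖T (g x)‖ₑ ^ 2 ∂μ = ENNReal.ofReal (∫ x, ‖T (g x)‖ ^ 2 ∂μ) := by
        rw [ofReal_integral_eq_lintegral_ofReal integrable_norm_sq
          (ae_of_all _ fun x => sq_nonneg _)]
        simp_rw [ENNReal.ofReal_pow (norm_nonneg _), ofReal_norm]
    _ = ENNReal.ofReal (∑ i, ∑ j, inner ℝ (T (w i)) (T (w j)) * Matrix.diagonal lam i j) := by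
        simp_rw [expand]
        rw [integral_finsetSum _ fun i _ => integrable_finsetSum _ fun j _ => integrable i j]
        simp_rw [integral_finsetSum _ fun j _ => integrable _ j, integral_const_mul,
          w, integral_inner_columnBasis_mul hg hW]
    _ = ENNReal.ofReal (∑ i, lam i * ‖T (w i)‖ ^ 2) := by
        simp [Matrix.diagonal_apply, mul_comm]

end PrincipalComponents

section InactiveGradient

variable {D d : ℕ}

theorem sum_mul_sq_le_sq_add_sqrt {lam t : Fin D → ℝ} {δ : ℝ} (hlam : ∀ i, 0 ≤ lam i)
    (ht : ∀ i, 0 ≤ t i) (ht_active : ∀ i : Fin D, i.val < d → t i ≤ δ) (ht_one : ∀ i, t i ≤ 1)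
    (hδ : 0 ≤ δ) :
    ∑ i, lam i * t i ^ 2 ≤ (δ * Real.sqrt (∑ i : Fin D with i.val < d, lam i)
      + Real.sqrt (∑ i : Fin D with d ≤ i.val, lam i)) ^ 2 := by
  set a := ∑ i : Fin D with i.val < d, lam i
  set b := ∑ i : Fin D with d ≤ i.val, lam i
  have a_nonneg : 0 ≤ a := Finset.sum_nonneg fun i _ => hlam i
  have b_nonneg : 0 ≤ b := Finset.sum_nonneg fun i _ => hlam i
  calc ∑ i, lam i * t i ^ 2
      = (∑ i : Fin D with i.val < d, lam i * t i ^ 2)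
        + ∑ i : Fin D with d ≤ i.val, lam i * t i ^ 2 := by
        simp only [← not_lt, Finset.sum_filter_add_sum_filter_not]
    _ ≤ (∑ i : Fin D with i.val < d, lam i * δ ^ 2)
        + ∑ i : Fin D with d ≤ i.val, lam i := by
        refine add_le_add (Finset.sum_le_sum fun i hi => ?_) (Finset.sum_le_sum fun i _ => ?_)
        · exact mul_le_mul_of_nonneg_left
            (pow_le_pow_left₀ (ht i) (ht_active i (Finset.mem_filter.1 hi).2) 2) (hlam i)
        · exact mul_le_of_le_one_right (hlam i) (pow_le_one₀ (ht i) (ht_one i))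
    _ = (δ * Real.sqrt a) ^ 2 + Real.sqrt b ^ 2 := by
        rw [← Finset.sum_mul, mul_pow, Real.sq_sqrt a_nonneg, Real.sq_sqrt b_nonneg, mul_comm]
    _ ≤ (δ * Real.sqrt a + Real.sqrt b) ^ 2 := by
        have : 0 ≤ δ * Real.sqrt a * Real.sqrt b := by positivity
        linarith [add_sq (δ * Real.sqrt a) (Real.sqrt b)]

theorem lintegral_enorm_inactiveVar_sq_le {𝓧 : Type*} {m𝓧 : MeasurableSpace 𝓧} {μ : Measure 𝓧}
    {g : 𝓧 → E D} {W Wc : Matrix (Fin D) (Fin D) ℝ} {lam : Fin D → ℝ} {δ : ℝ} (hd : d < D)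
    (hg : MemLp g 2 μ) (hW : IsEigendecomposition (secondMomentMatrix μ g) W lam)
    (hWc : Wc ∈ Matrix.orthogonalGroup (Fin D) ℝ)
    (hδ : ‖Matrix.toEuclideanCLM (n := Fin D) (𝕜 := ℝ) (W - Wc)‖ ≤ δ) :
    ∫⁻ x, ‖inactiveVar hd Wc (g x)‖ₑ ^ 2 ∂μ
      ≤ ENNReal.ofReal ((δ * Real.sqrt (∑ i : Fin D with i.val < d, lam i)
          + Real.sqrt (∑ i : Fin D with d ≤ i.val, lam i)) ^ 2) := by
  rw [lintegral_enorm_map_sq_eq _ hg hW]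
  exact ENNReal.ofReal_le_ofReal (sum_mul_sq_le_sq_add_sqrt (eigenvalue_nonneg hg hW)
    (fun _ => norm_nonneg _)
    (fun i hi => (norm_inactiveVar_columnBasis_le hd hW.orthogonal hi).trans hδ)
    (norm_inactiveVar_columnBasis_le_one hd hW.orthogonal hWc) ((norm_nonneg _).trans hδ))

end InactiveGradient

theorem strongConvexOn_comp_affineIsometry {F G : Type*} [NormedAddCommGroup F] [NormedSpace ℝ F]
    [NormedAddCommGroup G] [NormedSpace ℝ G] {s : Set G} {m : ℝ} {V : G → ℝ}
    (hV : StrongConvexOn s m V) (A : F →ᵃⁱ[ℝ] G) : StrongConvexOn (A ⁻¹' s) m (V ∘ A) := by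
  refine ⟨hV.1.affine_preimage A.toAffineMap, fun x hx y hy a b ha hb hab => ?_⟩
  have A_combo : A (a • x + b • y) = a • A x + b • A y :=
    Convex.combo_affine_apply (f := A.toAffineMap) hab
  have norm_sub : ‖A x - A y‖ = ‖x - y‖ := by
    rw [← dist_eq_norm, A.dist_map, dist_eq_norm]
  simpa only [Function.comp_apply, A_combo, norm_sub] using hV.2 hx hy ha hb hab

section AdmissibleDensity

variable {D : ℕ} {X : Set (E D)} {ρ : E D → ℝ}

theorem IsAdmissibleDensity.nonneg (hρ : IsAdmissibleDensity X ρ) (x : E D) : 0 ≤ ρ x := by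
  obtain ⟨V, α, c, C, -, hc, -, hcomp⟩ := hρ.comparable
  by_cases hx : x ∈ X
  · exact le_trans (by positivity) (hcomp x hx).1
  · rw [hρ.eq_zero_of_notMem x hx]

theorem IsAdmissibleDensity.integrable (hρ : IsAdmissibleDensity X ρ) : Integrable ρ :=
  .of_integral_ne_zero (by simp [hρ.integral_eq_one])

theorem IsAdmissibleDensity.isProbabilityMeasure (hρ : IsAdmissibleDensity X ρ) :
    IsProbabilityMeasure (densityMeasure ρ) := by
  constructor
  rw [densityMeasure, withDensity_apply _ MeasurableSet.univ, setLIntegral_univ,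
    ← ofReal_integral_eq_lintegral_ofReal hρ.integrable (ae_of_all _ hρ.nonneg),
    hρ.integral_eq_one, ofReal_one]

end AdmissibleDensity

section Fibers

variable {D d : ℕ} (hd : d < D) {W : Matrix (Fin D) (Fin D) ℝ} {X : Set (E D)} {ρ f : E D → ℝ}

theorem measurable_recombine (W : Matrix (Fin D) (Fin D) ℝ) :
    Measurable fun p : E d × E (D - d) => recombine hd W p.1 p.2 := by
  refine (WithLp.measurable_toLp 2 _).comp (measurable_pi_lambda _ fun a => ?_)
  simp only [Pi.add_apply, Matrix.mulVec, dotProduct]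
  fun_prop

theorem measurable_activeVar (W : Matrix (Fin D) (Fin D) ℝ) : Measurable (activeVar hd W) := by
  refine (WithLp.measurable_toLp 2 _).comp (measurable_pi_lambda _ fun a => ?_)
  simp only [Matrix.mulVec, dotProduct]
  fun_prop

theorem hasFDerivAt_recombine (y : E d) (z : E (D - d)) :
    HasFDerivAt (recombine hd W y) (inactiveMap hd W) z := by
  have : recombine hd W y = fun z => recombine hd W y 0 + inactiveMap hd W z :=
    funext (recombine_eq_add_inactiveMap hd y)
  rw [this]
  exact (inactiveMap hd W).hasFDerivAt.const_add _

theorem enorm_fderiv_comp_recombine {y : E d} {z : E (D - d)}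
    (hf : DifferentiableAt ℝ f (recombine hd W y z)) :
    ‖fderiv ℝ (fun z => f (recombine hd W y z)) z‖ₑ
      = ‖inactiveVar hd W (gradient f (recombine hd W y z))‖ₑ := by
  have chain := (hf.hasFDerivAt.comp z (hasFDerivAt_recombine hd y z)).fderiv
  have riesz : (fderiv ℝ f (recombine hd W y z)).comp (inactiveMap hd W)
      = innerSL ℝ (inactiveVar hd W (gradient f (recombine hd W y z))) := by
    ext1 v
    rw [innerSL_apply_apply, inactiveVar, ContinuousLinearMap.adjoint_inner_left, gradient,
      InnerProductSpace.toDual_symm_apply, ContinuousLinearMap.comp_apply]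
  rw [Function.comp_def] at chain
  rw [chain, riesz, ← ofReal_norm, innerSL_apply_norm, ofReal_norm]

/-- The measure `ρ(W₁ y + W₂ z) dz` on the fiber over `y`. It is the conditional law of `z` given
`y` up to normalization, which is omitted so that it is defined for every `y`. -/
def fiberMeasure (W : Matrix (Fin D) (Fin D) ℝ) (ρ : E D → ℝ) (y : E d) : Measure (E (D - d)) :=
  densityMeasure fun z => ρ (recombine hd W y z)

theorem lintegral_densityMeasure_eq (hρ : Measurable ρ)
    (hW : W ∈ Matrix.orthogonalGroup (Fin D) ℝ) {h : E D → ℝ≥0∞} (hh : Measurable h) :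
    ∫⁻ x, h x ∂(densityMeasure ρ)
      = ∫⁻ y, ∫⁻ z, h (recombine hd W y z) ∂(fiberMeasure hd W ρ y) := by
  have measurable_rec := measurable_recombine hd W
  have measurable_fiber (y : E d) : Measurable fun z => recombine hd W y z :=
    measurable_rec.comp measurable_prodMk_left
  have fiber_integral (y : E d) : ∫⁻ z, h (recombine hd W y z) ∂(fiberMeasure hd W ρ y)
      = ∫⁻ z, ENNReal.ofReal (ρ (recombine hd W y z)) * h (recombine hd W y z) :=
    lintegral_withDensity_eq_lintegral_mul _ (hρ.comp (measurable_fiber y)).ennreal_ofReal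
      (hh.comp (measurable_fiber y))
  simp_rw [fiber_integral]
  rw [densityMeasure, lintegral_withDensity_eq_lintegral_mul _ hρ.ennreal_ofReal hh,
    ← (measurePreserving_recombine hd hW).lintegral_comp (hρ.ennreal_ofReal.mul hh)]
  exact lintegral_prod _ ((hρ.ennreal_ofReal.mul hh).comp measurable_rec).aemeasurable

theorem ae_fiberMeasure_univ_eq (hρ : Integrable ρ) (hρ_nonneg : ∀ x, 0 ≤ ρ x)
    (hW : W ∈ Matrix.orthogonalGroup (Fin D) ℝ) :
    ∀ᵐ y : E d, fiberMeasure hd W ρ y univ = ENNReal.ofReal (marginalDensity hd W ρ y) := by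
  have integrable_fiber : ∀ᵐ y : E d, Integrable fun z => ρ (recombine hd W y z) :=
    ((measurePreserving_recombine hd hW).integrable_comp_of_integrable hρ).prod_right_ae
  filter_upwards [integrable_fiber] with y hy
  rw [fiberMeasure, densityMeasure, withDensity_apply _ MeasurableSet.univ, setLIntegral_univ,
    marginalDensity, ofReal_integral_eq_lintegral_ofReal hy (ae_of_all _ fun z => hρ_nonneg _)]

/-- The frontier of a convex set is a null set. -/
theorem ae_fiberMeasure_recombine_mem_interior (hX : Convex ℝ X) (hρ : Measurable ρ)
    (hρX : ∀ x, x ∉ X → ρ x = 0) (hW : W ∈ Matrix.orthogonalGroup (Fin D) ℝ) :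
    ∀ᵐ y : E d, ∀ᵐ z ∂(fiberMeasure hd W ρ y), recombine hd W y z ∈ interior X := by
  have mem_interior : ∀ᵐ x : E D, ENNReal.ofReal (ρ x) ≠ 0 → x ∈ interior X := by
    filter_upwards [measure_eq_zero_iff_ae_notMem.1 (hX.addHaar_frontier volume)] with x hx hρx
    have x_mem : x ∈ X := by_contra fun hxX => hρx (by rw [hρX x hxX, ofReal_zero])
    exact by_contra fun hxi => hx ⟨subset_closure x_mem, hxi⟩
  have on_fibers := Measure.ae_ae_of_ae_prod
    ((measurePreserving_recombine hd hW).quasiMeasurePreserving.ae mem_interior)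
  filter_upwards [on_fibers] with y hy
  have measurable_fiber : Measurable fun z => ρ (recombine hd W y z) :=
    hρ.comp ((measurable_recombine hd W).comp measurable_prodMk_left)
  rwa [fiberMeasure, densityMeasure, ae_withDensity_iff measurable_fiber.ennreal_ofReal]

theorem pairEnergy_fiberMeasure_le {V : E D → ℝ} {α c C : ℝ} (hα : 0 < α) (hc : 0 < c)
    (hV : StrongConvexOn X α V)
    (hcomp : ∀ x ∈ X, c * Real.exp (-V x) ≤ ρ x ∧ ρ x ≤ C * Real.exp (-V x))
    (hW : W ∈ Matrix.orthogonalGroup (Fin D) ℝ) (hf : Measurable f)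
    (hfd : ∀ x ∈ interior X, DifferentiableAt ℝ f x) {y : E d}
    (hy : ∀ᵐ z ∂(fiberMeasure hd W ρ y), recombine hd W y z ∈ interior X) :
    pairEnergy (fiberMeasure hd W ρ y) (fun z => f (recombine hd W y z))
      ≤ ENNReal.ofReal (C / c) ^ 2 * ENNReal.ofReal (4 / α) * (fiberMeasure hd W ρ y univ *
        ∫⁻ z, ‖inactiveVar hd W (gradient f (recombine hd W y z))‖ₑ ^ 2
          ∂(fiberMeasure hd W ρ y)) := by
  have hV_interior : StrongConvexOn (interior X) α V :=
    ⟨hV.1.interior, fun _ hx _ hz => hV.2 (interior_subset hx) (interior_subset hz)⟩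
  have energy_eq : dirichletEnergy (fiberMeasure hd W ρ y) (fun z => f (recombine hd W y z))
      = ∫⁻ z, ‖inactiveVar hd W (gradient f (recombine hd W y z))‖ₑ ^ 2
          ∂(fiberMeasure hd W ρ y) := by
    refine lintegral_congr_ae ?_
    filter_upwards [hy] with z hz
    rw [enorm_fderiv_comp_recombine hd (hfd _ hz)]
  rw [← energy_eq]
  exact pairEnergy_le_of_comparable hα
    (strongConvexOn_comp_affineIsometry hV_interior (fiberIsometry hd hW y))
    (isOpen_interior.preimage (fiberIsometry hd hW y).continuous) hc
    (fun z hz => (hcomp _ (interior_subset hz)).1) (fun z hz => (hcomp _ (interior_subset hz)).2) hy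
    (hf.comp ((measurable_recombine hd W).comp measurable_prodMk_left))
    fun z hz => (hfd _ hz).comp z (hasFDerivAt_recombine hd y z).differentiableAt

/-- The conditional Poincaré inequality, with one constant for all dimensions and directions of
the fibers: restriction to a subspace preserves strong convexity and its modulus. -/
theorem IsAdmissibleDensity.exists_pairEnergy_fiberMeasure_le (hρ : IsAdmissibleDensity X ρ) :
    ∃ κ : ℝ≥0∞, κ ≠ ∞ ∧ ∀ {d : ℕ} (hd : d < D) {W : Matrix (Fin D) (Fin D) ℝ},
      W ∈ Matrix.orthogonalGroup (Fin D) ℝ → ∀ {f : E D → ℝ}, Measurable f →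
      (∀ x ∈ interior X, DifferentiableAt ℝ f x) →
      ∀ᵐ y : E d, pairEnergy (fiberMeasure hd W ρ y) (fun z => f (recombine hd W y z))
        ≤ κ * (fiberMeasure hd W ρ y univ *
          ∫⁻ z, ‖inactiveVar hd W (gradient f (recombine hd W y z))‖ₑ ^ 2
            ∂(fiberMeasure hd W ρ y)) := by
  obtain ⟨V, α, c, C, hα, hc, hV, hcomp⟩ := hρ.comparable
  refine ⟨ENNReal.ofReal (C / c) ^ 2 * ENNReal.ofReal (4 / α), by finiteness, ?_⟩
  intro d hd W hW f hf hfd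
  filter_upwards [ae_fiberMeasure_recombine_mem_interior hd hρ.convex hρ.measurable
    hρ.eq_zero_of_notMem hW] with y hy
  exact pairEnergy_fiberMeasure_le hd hα hc hV hcomp hW hf hfd hy

end Fibers

section Sampling

variable {D d : ℕ} {hd : d < D} {W : Matrix (Fin D) (Fin D) ℝ} {ρ f : E D → ℝ}
  {Ω : Type*} [MeasurableSpace Ω] {P : Measure Ω} {Z : Ω → E d → E (D - d)}

/-- A random point of each fiber: for every `y` with `p_Y(y) > 0`, the point `Z · y` has density
`p_{Z|Y}(·|y)`. The samples of an `IsConditionalSampler` have this property individually. -/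
structure IsFiberSampler (hd : d < D) (W : Matrix (Fin D) (Fin D) ℝ) (ρ : E D → ℝ) (P : Measure Ω)
    (Z : Ω → E d → E (D - d)) : Prop where
  measurable : Measurable fun p : Ω × E d => Z p.1 p.2
  law : ∀ y, 0 < marginalDensity hd W ρ y →
    P.map (fun ω => Z ω y) = volume.withDensity fun z => ENNReal.ofReal (condDensity hd W ρ y z)

theorem IsConditionalSampler.isFiberSampler {N : ℕ} {Z : Fin N → Ω → E d → E (D - d)}
    (hZ : IsConditionalSampler hd W ρ P Z) (i : Fin N) : IsFiberSampler hd W ρ P (Z i) :=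
  ⟨hZ.measurable i, hZ.law i⟩

theorem IsFiberSampler.map_eq_smul_fiberMeasure (hZ : IsFiberSampler hd W ρ P Z)
    (hρ : Measurable ρ) {y : E d} (hy : 0 < marginalDensity hd W ρ y) :
    P.map (fun ω => Z ω y)
      = (ENNReal.ofReal (marginalDensity hd W ρ y))⁻¹ • fiberMeasure hd W ρ y := by
  have measurable_fiber : Measurable fun z => ρ (recombine hd W y z) :=
    hρ.comp ((measurable_recombine hd W).comp measurable_prodMk_left)
  rw [hZ.law y hy, fiberMeasure, densityMeasure,
    ← withDensity_smul _ measurable_fiber.ennreal_ofReal]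
  congr 1
  ext z
  rw [condDensity, ENNReal.ofReal_div_of_pos hy, div_eq_mul_inv, mul_comm, Pi.smul_apply,
    smul_eq_mul]

theorem IsFiberSampler.lintegral_lintegral_sq_sub_eq (hZ : IsFiberSampler hd W ρ P Z)
    (hρ : Measurable ρ) {y : E d} (hy : 0 < marginalDensity hd W ρ y) {h : E (D - d) → ℝ}
    (hh : Measurable h) :
    ∫⁻ z, ∫⁻ ω, ‖h z - h (Z ω y)‖ₑ ^ 2 ∂P ∂(fiberMeasure hd W ρ y)
      = (ENNReal.ofReal (marginalDensity hd W ρ y))⁻¹ * pairEnergy (fiberMeasure hd W ρ y) h := by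
  have inner_eq (z : E (D - d)) : ∫⁻ ω, ‖h z - h (Z ω y)‖ₑ ^ 2 ∂P
      = (ENNReal.ofReal (marginalDensity hd W ρ y))⁻¹ *
        ∫⁻ z', ‖h z - h z'‖ₑ ^ 2 ∂(fiberMeasure hd W ρ y) := by
    have measurable_sample : Measurable fun ω => Z ω y :=
      hZ.measurable.comp measurable_prodMk_right
    rw [← smul_eq_mul, ← lintegral_smul_measure, ← hZ.map_eq_smul_fiberMeasure hρ hy]
    exact (lintegral_map (f := fun z' => ‖h z - h z'‖ₑ ^ 2) (by fun_prop) measurable_sample).symm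
  simp_rw [inner_eq]
  exact lintegral_const_mul' _ _ (ENNReal.inv_ne_top.2 (by simpa using hy))

theorem IsFiberSampler.lintegral_lintegral_sq_sub_le (hZ : IsFiberSampler hd W ρ P Z)
    (hρ : Measurable ρ) {y : E d}
    (hy : fiberMeasure hd W ρ y univ = ENNReal.ofReal (marginalDensity hd W ρ y))
    {h : E (D - d) → ℝ} (hh : Measurable h) {κ A : ℝ≥0∞}
    (hpoincare : pairEnergy (fiberMeasure hd W ρ y) h ≤ κ * (fiberMeasure hd W ρ y univ * A)) :
    ∫⁻ z, ∫⁻ ω, ‖h z - h (Z ω y)‖ₑ ^ 2 ∂P ∂(fiberMeasure hd W ρ y) ≤ κ * A := by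
  rcases le_or_gt (marginalDensity hd W ρ y) 0 with marginal_nonpos | marginal_pos
  · have : fiberMeasure hd W ρ y = 0 := by
      rw [← Measure.measure_univ_eq_zero, hy, ofReal_of_nonpos marginal_nonpos]
    simp [this]
  · rw [hZ.lintegral_lintegral_sq_sub_eq hρ marginal_pos hh]
    refine (mul_le_mul_right hpoincare _).trans_eq ?_
    rw [hy, mul_left_comm, ← mul_assoc (ENNReal.ofReal _)⁻¹,
      ENNReal.inv_mul_cancel (by simpa using marginal_pos) ofReal_ne_top, one_mul]

/-- The point of the fiber of `activeVar` through `x` picked by the sampler `Z`. -/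
def resample (hd : d < D) (W : Matrix (Fin D) (Fin D) ℝ) (Z : Ω → E d → E (D - d)) (x : E D)
    (ω : Ω) : E D :=
  recombine hd W (activeVar hd W x) (Z ω (activeVar hd W x))

theorem IsFiberSampler.measurable_resample (hZ : IsFiberSampler hd W ρ P Z) :
    Measurable fun p : E D × Ω => resample hd W Z p.1 p.2 := by
  have measurable_active : Measurable fun p : E D × Ω => activeVar hd W p.1 :=
    (measurable_activeVar hd W).comp measurable_fst
  exact (measurable_recombine hd W).comp
    (measurable_active.prodMk (hZ.measurable.comp (measurable_snd.prodMk measurable_active)))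

theorem IsFiberSampler.lintegral_sq_sub_resample_le [SFinite P] (hZ : IsFiberSampler hd W ρ P Z)
    (hρ : Measurable ρ) (hρ_int : Integrable ρ) (hρ_nonneg : ∀ x, 0 ≤ ρ x)
    (hW : W ∈ Matrix.orthogonalGroup (Fin D) ℝ) (hf : Measurable f) {κ : ℝ≥0∞} (hκ : κ ≠ ∞)
    (hpoincare : ∀ᵐ y : E d, pairEnergy (fiberMeasure hd W ρ y) (fun z => f (recombine hd W y z))
      ≤ κ * (fiberMeasure hd W ρ y univ *
        ∫⁻ z, ‖inactiveVar hd W (gradient f (recombine hd W y z))‖ₑ ^ 2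
          ∂(fiberMeasure hd W ρ y))) :
    ∫⁻ x, ∫⁻ ω, ‖f x - f (resample hd W Z x ω)‖ₑ ^ 2 ∂P ∂(densityMeasure ρ)
      ≤ κ * ∫⁻ x, ‖inactiveVar hd W (gradient f x)‖ₑ ^ 2 ∂(densityMeasure ρ) := by
  have measurable_sq : Measurable fun p : E D × Ω => ‖f p.1 - f (resample hd W Z p.1 p.2)‖ₑ ^ 2 :=
    ((hf.comp measurable_fst).sub (hf.comp hZ.measurable_resample)).enorm.pow_const 2
  have measurable_gradient : Measurable (gradient f) :=
    (InnerProductSpace.toDual ℝ (E D)).symm.continuous.measurable.comp (measurable_fderiv ℝ f)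
  have measurable_gradient_sq : Measurable fun x => ‖inactiveVar hd W (gradient f x)‖ₑ ^ 2 := by
    fun_prop
  rw [lintegral_densityMeasure_eq hd hρ hW measurable_sq.lintegral_prod_right',
    lintegral_densityMeasure_eq hd hρ hW measurable_gradient_sq, ← lintegral_const_mul' _ _ hκ]
  simp only [resample, activeVar_recombine hd hW]
  refine lintegral_mono_ae ?_
  filter_upwards [hpoincare, ae_fiberMeasure_univ_eq hd hρ_int hρ_nonneg hW] with y hy hy_univ
  exact hZ.lintegral_lintegral_sq_sub_le hρ hy_univ
    (hf.comp ((measurable_recombine hd W).comp measurable_prodMk_left)) hy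

end Sampling

theorem exists_pos_le_ofReal_sq {κ : ℝ≥0∞} (hκ : κ ≠ ∞) :
    ∃ r : ℝ, 0 < r ∧ κ ≤ ENNReal.ofReal r ^ 2 := by
  have toReal_nonneg : 0 ≤ κ.toReal := ENNReal.toReal_nonneg
  refine ⟨κ.toReal + 1, by positivity, ?_⟩
  rw [← ENNReal.ofReal_pow (by positivity), ENNReal.le_ofReal_iff_toReal_le hκ (by positivity)]
  nlinarith

theorem eLpNorm_sub_average_le {ι 𝓧 G : Type*} {m𝓧 : MeasurableSpace 𝓧} {μ : Measure 𝓧}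
    [NormedAddCommGroup G] [NormedSpace ℝ G] {p : ℝ≥0∞} (hp : 1 ≤ p) {s : Finset ι}
    (hs : s.Nonempty) {f : 𝓧 → G} {u : ι → 𝓧 → G}
    (hu : ∀ i ∈ s, AEStronglyMeasurable (f - u i) μ) {c : ℝ≥0∞}
    (hc : ∀ i ∈ s, eLpNorm (f - u i) p μ ≤ c) :
    eLpNorm (f - (s.card : ℝ)⁻¹ • ∑ i ∈ s, u i) p μ ≤ c := by
  have card_ne_zero : (s.card : ℝ) ≠ 0 := by exact_mod_cast hs.card_ne_zero
  have average : f - (s.card : ℝ)⁻¹ • ∑ i ∈ s, u i = (s.card : ℝ)⁻¹ • ∑ i ∈ s, (f - u i) := by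
    rw [Finset.sum_sub_distrib, Finset.sum_const, smul_sub, ← Nat.cast_smul_eq_nsmul ℝ,
      inv_smul_smul₀ card_ne_zero]
  calc eLpNorm (f - (s.card : ℝ)⁻¹ • ∑ i ∈ s, u i) p μ
      = ‖(s.card : ℝ)⁻¹‖ₑ * eLpNorm (∑ i ∈ s, (f - u i)) p μ := by
        rw [average, eLpNorm_const_smul]
    _ ≤ ‖(s.card : ℝ)⁻¹‖ₑ * ∑ _i ∈ s, c := by
        gcongr
        exact (eLpNorm_sum_le hu hp).trans (Finset.sum_le_sum hc)
    _ = c := by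
        rw [Finset.sum_const, nsmul_eq_mul, ← mul_assoc, enorm_inv card_ne_zero, Real.enorm_natCast,
          ENNReal.inv_mul_cancel (by exact_mod_cast hs.card_ne_zero) (natCast_ne_top _), one_mul]

section RootMeanSquare

variable {D : ℕ} {ρ : E D → ℝ} {Ω : Type*} [MeasurableSpace Ω] {P : Measure Ω}

theorem rmsNorm_sq_eq [SFinite P] {g : Ω → E D → ℝ}
    (hg : Measurable fun p : E D × Ω => g p.2 p.1) :
    rmsNorm ρ P g ^ 2 = ∫⁻ x, ∫⁻ ω, ‖g ω x‖ₑ ^ 2 ∂P ∂(densityMeasure ρ) := by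
  have := eLpNorm_nnreal_pow_eq_lintegral (p := 2) (f := fun p : E D × Ω => g p.2 p.1)
    (μ := (densityMeasure ρ).prod P) two_ne_zero
  simp only [NNReal.coe_ofNat, ENNReal.rpow_ofNat, ENNReal.coe_ofNat] at this
  rw [rmsNorm, this, lintegral_prod _ (hg.enorm.pow_const 2).aemeasurable]

theorem rmsNorm_sub_le {a b c : Ω → E D → ℝ} (ha : Measurable fun p : E D × Ω => a p.2 p.1)
    (hb : Measurable fun p : E D × Ω => b p.2 p.1) (hc : Measurable fun p : E D × Ω => c p.2 p.1) :
    rmsNorm ρ P (fun ω x => a ω x - c ω x)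
      ≤ rmsNorm ρ P (fun ω x => a ω x - b ω x) + rmsNorm ρ P (fun ω x => b ω x - c ω x) := by
  simpa only [rmsNorm, Pi.add_def, Pi.sub_apply, sub_add_sub_cancel] using
    eLpNorm_add_le (ha.fun_sub hb).aestronglyMeasurable (hb.fun_sub hc).aestronglyMeasurable
      (μ := (densityMeasure ρ).prod P) (p := 2) one_le_two

theorem rmsNorm_const [IsProbabilityMeasure (densityMeasure ρ)] [IsProbabilityMeasure P] (r : ℝ) :
    rmsNorm ρ P (fun _ _ => r) = ENNReal.ofReal |r| := by
  rw [rmsNorm, eLpNorm_const _ two_ne_zero (NeZero.ne _), measure_univ, ENNReal.one_rpow, mul_one,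
    Real.enorm_eq_ofReal_abs]

end RootMeanSquare

section Surrogates

variable {D d N : ℕ} {hd : d < D} {W : Matrix (Fin D) (Fin D) ℝ} {ρ f : E D → ℝ}
  {Ω : Type*} [MeasurableSpace Ω] {P : Measure Ω}

theorem measurable_comp_activeVar {g : Ω → E d → ℝ}
    (hg : Measurable fun p : Ω × E d => g p.1 p.2) :
    Measurable fun p : E D × Ω => g p.2 (activeVar hd W p.1) :=
  hg.comp (measurable_snd.prodMk ((measurable_activeVar hd W).comp measurable_fst))

theorem measurable_fMC {Z : Fin N → Ω → E d → E (D - d)}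
    (hZ : ∀ i, Measurable fun p : Ω × E d => Z i p.1 p.2) (hf : Measurable f) :
    Measurable fun p : Ω × E d => fMC hd W f Z p.1 p.2 :=
  (Finset.measurable_fun_sum _ fun i _ =>
    hf.comp ((measurable_recombine hd W).comp (measurable_snd.prodMk (hZ i)))).const_mul _

theorem measurable_fGPRBiased {s : ℕ} {Z : Fin N → Ω → E d → E (D - d)}
    (hZ : ∀ i, Measurable fun p : Ω × E d => Z i p.1 p.2) (hf : Measurable f)
    {k : E d → E d → ℝ} (hk : Measurable fun p : E d × E d => k p.1 p.2) (ytr : Fin s → E d)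
    (β : ℝ) : Measurable fun p : Ω × E d => fGPRBiased hd W f Z k ytr β p.1 p.2 := by
  have training_data (j : Fin s) :
      Measurable fun p : Ω × E d => fMCBiased hd W f Z β p.1 (ytr j) :=
    ((measurable_fMC hZ hf).comp (measurable_fst.prodMk measurable_const)).add_const β
  simp only [fGPRBiased, gprMean, Matrix.mulVec, dotProduct]
  exact Finset.measurable_fun_sum _ fun i _ => Measurable.fun_mul
    (hk.comp (measurable_snd.prodMk measurable_const))
    (Finset.measurable_fun_sum _ fun j _ => (training_data j).const_mul _)

theorem IsFiberSampler.rmsNorm_sub_resample_le [SFinite P] {Z : Ω → E d → E (D - d)}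
    {Wc : Matrix (Fin D) (Fin D) ℝ} {lam : Fin D → ℝ} {δ K : ℝ}
    (hZ : IsFiberSampler hd Wc ρ P Z) (hρ : Measurable ρ) (hρ_int : Integrable ρ)
    (hρ_nonneg : ∀ x, 0 ≤ ρ x) (hf : Measurable f)
    (hgrad : MemLp (gradient f) 2 (densityMeasure ρ))
    (hW : IsEigendecomposition (gradientCovariance ρ f) W lam)
    (hWc : Wc ∈ Matrix.orthogonalGroup (Fin D) ℝ)
    (hδ : ‖Matrix.toEuclideanCLM (n := Fin D) (𝕜 := ℝ) (W - Wc)‖ ≤ δ) (hK : 0 ≤ K)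
    (hpoincare : ∀ᵐ y : E d, pairEnergy (fiberMeasure hd Wc ρ y) (fun z => f (recombine hd Wc y z))
      ≤ ENNReal.ofReal K ^ 2 * (fiberMeasure hd Wc ρ y univ *
        ∫⁻ z, ‖inactiveVar hd Wc (gradient f (recombine hd Wc y z))‖ₑ ^ 2
          ∂(fiberMeasure hd Wc ρ y))) :
    rmsNorm ρ P (fun ω x => f x - f (resample hd Wc Z x ω))
      ≤ ENNReal.ofReal (K * (δ * Real.sqrt (∑ i : Fin D with i.val < d, lam i)
          + Real.sqrt (∑ i : Fin D with d ≤ i.val, lam i))) := by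
  set S := δ * Real.sqrt (∑ i : Fin D with i.val < d, lam i)
    + Real.sqrt (∑ i : Fin D with d ≤ i.val, lam i)
  have S_nonneg : 0 ≤ S :=
    add_nonneg (mul_nonneg ((norm_nonneg _).trans hδ) (Real.sqrt_nonneg _)) (Real.sqrt_nonneg _)
  refine (ENNReal.pow_le_pow_left_iff two_ne_zero).1 ?_
  rw [rmsNorm_sq_eq ((hf.comp measurable_fst).sub (hf.comp hZ.measurable_resample)),
    ENNReal.ofReal_mul hK, mul_pow, ← ENNReal.ofReal_pow S_nonneg]
  exact (hZ.lintegral_sq_sub_resample_le hρ hρ_int hρ_nonneg hWc hf (by finiteness) hpoincare).trans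
    (mul_le_mul_right (lintegral_enorm_inactiveVar_sq_le hd hgrad hW hWc hδ) _)

theorem rmsNorm_sub_fMC_le {Z : Fin N → Ω → E d → E (D - d)} (hN : 0 < N)
    (hZ : ∀ i, IsFiberSampler hd W ρ P (Z i)) (hf : Measurable f) {c : ℝ≥0∞}
    (hc : ∀ i, rmsNorm ρ P (fun ω x => f x - f (resample hd W (Z i) x ω)) ≤ c) :
    rmsNorm ρ P (fun ω x => f x - fMC hd W f Z ω (activeVar hd W x)) ≤ c := by
  have : Nonempty (Fin N) := ⟨⟨0, hN⟩⟩
  have average := eLpNorm_sub_average_le one_le_two Finset.univ_nonempty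
    (f := fun p : E D × Ω => f p.1) (u := fun i p => f (resample hd W (Z i) p.1 p.2))
    (fun i _ => ((hf.comp measurable_fst).sub
      (hf.comp (hZ i).measurable_resample)).aestronglyMeasurable) fun i _ => hc i
  rw [rmsNorm]
  convert average using 2
  funext p
  simp [fMC, resample]

end Surrogates

theorem mainTheorem3_general {D : ℕ} (X : Set (E D)) (ρ : E D → ℝ)
    (hρ : IsAdmissibleDensity X ρ) :
    ∃ C₁ : ℝ, 0 < C₁ ∧
      ∀ (d N : ℕ) (hd : d < D) (_ : 0 < N) (f : E D → ℝ) (_ : Measurable f)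
        (_ : ∀ x ∈ interior X, DifferentiableAt ℝ f x)
        (_ : MemLp (gradient f) 2 (densityMeasure ρ))
        (W Wc : Matrix (Fin D) (Fin D) ℝ) (lam : Fin D → ℝ) (δ₁ : ℝ)
        (_ : IsEigendecomposition (gradientCovariance ρ f) W lam)
        (_ : Wc ∈ Matrix.orthogonalGroup (Fin D) ℝ)
        (_ : ‖Matrix.toEuclideanCLM (n := Fin D) (𝕜 := ℝ) (W - Wc)‖ ≤ δ₁)
        (Ω : Type*) [MeasurableSpace Ω] (P : Measure Ω) [IsProbabilityMeasure P]
        (Z : Fin N → Ω → E d → E (D - d)) (_ : ∀ i, IsFiberSampler hd Wc ρ P (Z i))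
        (g : Ω → E d → ℝ) (_ : Measurable fun p : Ω × E d => g p.1 p.2) (β : ℝ),
        rmsNorm ρ P (fun ω x => f x - g ω (activeVar hd Wc x))
          ≤ ENNReal.ofReal (C₁ * (δ₁ * Real.sqrt (∑ i : Fin D with i.val < d, lam i)
                + Real.sqrt (∑ i : Fin D with d ≤ i.val, lam i)))
            + ENNReal.ofReal |β|
            + rmsNorm ρ P (fun ω x => fMCBiased hd Wc f Z β ω (activeVar hd Wc x)
                - g ω (activeVar hd Wc x)) := by
  obtain ⟨κ, κ_ne_top, poincare⟩ := hρ.exists_pairEnergy_fiberMeasure_le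
  obtain ⟨C₁, C₁_pos, κ_le⟩ := exists_pos_le_ofReal_sq κ_ne_top
  refine ⟨C₁, C₁_pos, ?_⟩
  intro d N hd hN f hf hfd hgrad W Wc lam δ₁ hW hWc hδ Ω _ P _ Z hZ g hg β
  have := hρ.isProbabilityMeasure
  have measurable_f : Measurable fun p : E D × Ω => f p.1 := hf.comp measurable_fst
  have measurable_MC := measurable_comp_activeVar (hd := hd) (W := Wc)
    (measurable_fMC (hd := hd) (W := Wc) (fun i => (hZ i).measurable) hf)
  have sampling_error := rmsNorm_sub_fMC_le hN hZ hf fun i =>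
    (hZ i).rmsNorm_sub_resample_le hρ.measurable hρ.integrable hρ.nonneg hf hgrad hW hWc hδ
      C₁_pos.le ((poincare hd hWc hf hfd).mono fun y hy => hy.trans (mul_le_mul_left κ_le _))
  have bias : rmsNorm ρ P (fun ω x => fMC hd Wc f Z ω (activeVar hd Wc x)
      - fMCBiased hd Wc f Z β ω (activeVar hd Wc x)) = ENNReal.ofReal |β| := by
    simp only [fMCBiased, sub_add_cancel_left, rmsNorm_const, abs_neg]
  calc rmsNorm ρ P (fun ω x => f x - g ω (activeVar hd Wc x))
      ≤ rmsNorm ρ P (fun ω x => f x - fMCBiased hd Wc f Z β ω (activeVar hd Wc x))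
        + rmsNorm ρ P (fun ω x => fMCBiased hd Wc f Z β ω (activeVar hd Wc x)
          - g ω (activeVar hd Wc x)) :=
        rmsNorm_sub_le measurable_f (measurable_MC.add_const β) (measurable_comp_activeVar hg)
    _ ≤ _ := by
        gcongr
        exact (rmsNorm_sub_le (b := fun ω x => fMC hd Wc f Z ω (activeVar hd Wc x)) measurable_f
          measurable_MC (measurable_MC.add_const β)).trans
          (add_le_add sampling_error bias.le)

end ActiveSubspace

end

open ActiveSubspace in
theorem mainTheorem3 {D : ℕ} (X : Set (E D)) (ρ : E D → ℝ) (hρ : IsAdmissibleDensity X ρ) :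
    ∃ C₁ : ℝ, 0 < C₁ ∧
      ∀ (d N s : ℕ) (_ : 0 < d) (hd : d < D) (_ : 0 < N)
        -- the function to be approximated
        (f : E D → ℝ) (_ : Measurable f) (_ : ∀ x ∈ interior X, DifferentiableAt ℝ f x)
        (_ : MemLp f 2 (densityMeasure ρ)) (_ : MemLp (gradient f) 2 (densityMeasure ρ))
        -- exact eigenvectors and eigenvalues, and the computed orthogonal matrix
        (W Wc : Matrix (Fin D) (Fin D) ℝ) (lam : Fin D → ℝ) (δ₁ : ℝ)
        (_ : IsEigendecomposition (gradientCovariance ρ f) W lam)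
        (_ : Wc ∈ Matrix.orthogonalGroup (Fin D) ℝ)
        (_ : ‖Matrix.toEuclideanCLM (n := Fin D) (𝕜 := ℝ) (W - Wc)‖ ≤ δ₁)
        -- Monte Carlo samples
        (Ω : Type*) [MeasurableSpace Ω] (P : Measure Ω) [IsProbabilityMeasure P]
        (Z : Fin N → Ω → E d → E (D - d)) (_ : IsConditionalSampler hd Wc ρ P Z)
        -- Gaussian process regression on the biased training data
        (k : E d → E d → ℝ) (_ : IsCovarianceKernel k)
        (ytr : Fin s → E d) (_ : ∀ i, ytr i ∈ activeVar hd Wc '' X) (_ : IsUnit (gram k ytr).det)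
        (β : ℝ) (_ : 0 ≤ β) (C₂ δ₂ : ℝ) (_ : 0 ≤ C₂) (_ : 0 ≤ δ₂)
        (_ : rmsNorm ρ P (fun ω x => fMCBiased hd Wc f Z β ω (activeVar hd Wc x)
              - fGPRBiased hd Wc f Z k ytr β ω (activeVar hd Wc x))
            ≤ ENNReal.ofReal (C₂ * δ₂)),
        rmsNorm ρ P (fun ω x => f x - fGPRBiased hd Wc f Z k ytr β ω (activeVar hd Wc x))
          ≤ ENNReal.ofReal
              (C₁ * (1 + 1 / Real.sqrt N)
                * (δ₁ * Real.sqrt (∑ i : Fin D with i.val < d, lam i)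
                    + Real.sqrt (∑ i : Fin D with d ≤ i.val, lam i))
                + C₂ * δ₂ + β) := by
  obtain ⟨C₁, C₁_pos, bound⟩ := mainTheorem3_general X ρ hρ
  refine ⟨C₁, C₁_pos, ?_⟩
  intro d N s _ hd hN f hf hfd _ hgrad W Wc lam δ₁ hW hWc hδ Ω _ P _ Z hZ k hk ytr _ _ β hβ C₂ δ₂
    hC₂ hδ₂ hgpr
  have δ₁_nonneg : 0 ≤ δ₁ := (norm_nonneg _).trans hδ
  have surrogate_bound := bound d N hd hN f hf hfd hgrad W Wc lam δ₁ hW hWc hδ Ω P Z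
    hZ.isFiberSampler (fGPRBiased hd Wc f Z k ytr β)
    (measurable_fGPRBiased hZ.measurable hf hk.measurable ytr β) β
  refine (surrogate_bound.trans (add_le_add_right hgpr _)).trans ?_
  rw [abs_of_nonneg hβ, ← ENNReal.ofReal_add (by positivity) hβ,
    ← ENNReal.ofReal_add (by positivity) (by positivity), add_right_comm]
  gcongr
  exact le_mul_of_one_le_right C₁_pos.le (le_add_of_nonneg_right (by positivity))
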